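/- **Lemma ($L^2$ ball inflation, in the plane).** *Scales, squares, tubes.* Let $M\ge 0$ be an integer, $\delta=2^{-M}$, $R\ge 1$, and $r_j=R^{2^j\delta}$ for $0\le j\le M$, so $r_0=R^\delta$ and $r_M=R$. $\mathcal D_{r_j/R}$ is the collection of half-open dyadic squares in $\mathbb R^2$ whose side is the largest power of $2$ not exceeding $r_j/R$; $\lambda Q$ is the dilate of $Q$ about its centre. A $w\times l$ tube is a rectangle with these side lengths, its direction being that of the side of length $l$; $\lambda T$ is the dilate about its centre. *Caps.* Fix a constant $K$. An $r^{-1}$-cap is a half-open arc of $S^1$ of length in $[K^{-1}r^{-1},Kr^{-1}]$; its direction is its midpoint. Let $S^1$ be partitioned into $r_0^{-1}$-caps $\theta_0$, each of these into $r_1^{-1}$-caps $\theta_1$, and so on down to $r_{M-1}^{-1}=R^{-1/2}$-caps $\theta=\theta_{M-1}$. Put $\theta_{-1}:=S^1$. *Functions.* For each $R^{-1/2}$-cap $\theta$ with midpoint $e_\theta$ let $\psi_\theta\ge 0$ be a smooth function on $\mathbb R^2$ vanishing outside the rectangle $\{\xi: 0\le \xi\cdot e_\theta\le KR,\ |\xi\cdot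 e_\theta^\perp|\le K R^{1/2}\}$, with $\sum_\theta\psi_\theta\le 1$. Let $\mu,\nu$ be Borel probability measures on $\mathbb R^2$, $t\in\mathbb R$, $\psi\in C_0^\infty(\mathbb R^2)$ with $\psi\ge 0$, $\Lambda\ge 1$, $R/\Lambda\le\rho\le\Lambda R$, and let $\sigma_\rho$ be the normalized arc length measure on $\rho S^1$. With $\hat\mu(\xi)=\int e^{-2\pi i x\cdot\xi}d\mu(x)$ and $^\vee$ the inverse Fourier transform, set $$F_\theta:=((\psi_\theta\hat\mu\,d\sigma_\rho)*\psi)^\vee,\qquad F_{\theta_j}:=\sum_{\theta\subset\theta_j}F_\theta\quad(-1\le j\le M-1).$$ *Bad caps.* For a measure $\omega$ write $\omega_Q=\omega(Q)^{-1}\omega|_Q$ (and $\omega_Q=0$ if $\omega(Q)=0$); $m$ is Lebesgue measure. For $0\le j\le M-1$ and $Q_j\in\mathcal D_{r_j/R}$, contained in $Q_{j+1}\in\mathcal D_{r_{j+1}/R}$, let $\Theta_j(Q_j)$ be the set of the $\theta_j$ such that the $r_j/R\times r_{j+1}/R$ tube $T$ with the centre of $Q_j$ and the direction of $\theta_j$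 satisfies $$\nu_{R^{2(j+2)\delta^2}Q_{j+1}}(R^\delta T)>R^{10\delta}(r_j/r_{j+1})^{\min\{t,1\}}.$$ If $Q_k\in\mathcal D_{r_k/R}$ with $k\le j$ and $Q_k\subset Q_j$, set $\Theta_j(Q_k):=\Theta_j(Q_j)$. Put $\Theta_M:=\emptyset$. For $k<j\le M-1$ let $\Theta_{=j}(Q_k)$ be the set of the caps in $\Theta_j(Q_k)$ that are disjoint from all caps in $\Theta_k(Q_k),\dots,\Theta_{j-1}(Q_k)$. For $0\le k\le M$ define $$F_{Q_k,\theta_{k-1}}:=F_{\theta_{k-1}}-\sum_{\theta_k\in\Theta_k(Q_k),\,\theta_k\subset\theta_{k-1}}F_{\theta_k}-\sum_{j=k+1}^{M-1}\ \sum_{\theta_j\in\Theta_{=j}(Q_k),\,\theta_j\subset\theta_{k-1}}F_{\theta_j}.$$ *Conclusion.* There is an absolute constant $C>0$, and for all $M,K,\Lambda,\psi$ there are constants $A$ and $(B_N)_{N\ge 0}$, depending only on $M,K,\Lambda,\psi$, such that for all $R,\rho$, all families of caps and of functions $\psi_\theta$, and all $\mu,\nu,t$ as above, for every $0\le k\le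 M-1$, every $Q_{k+1}\in\mathcal D_{r_{k+1}/R}$, every cap $\theta_{k-1}$ and every $N\ge 0$, $$\sum_{Q_k\in\mathcal D_{r_k/R},\,Q_k\subset Q_{k+1}}\nu(R^{2(k+1)\delta^2}Q_k)\int|F_{Q_k,\theta_{k-1}}|^2\,dm_{R^{2(k+1)\delta^2}Q_k}$$ $$\le A R^{C\delta}(r_k/r_{k+1})^{\min\{t,1\}-1}\sum_{\theta_k\subset\theta_{k-1}}\nu(R^{2(k+2)\delta^2}Q_{k+1})\int|F_{Q_{k+1},\theta_k}|^2\,dm_{R^{2(k+2)\delta^2}Q_{k+1}}+B_NR^{-N}.$$ -/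

import Mathlib

open MeasureTheory ProbabilityTheory Set
open scoped FourierTransform ENNReal ContDiff

noncomputable section

namespace BallInflation

/-- The Euclidean plane. -/
abbrev Plane : Type := EuclideanSpace ℝ (Fin 2)

/-! ### Scales -/

/-- The small parameter `δ = 2^{-M}`, so that `log₂ (1/δ) = M`. -/
def delta (M : ℕ) : ℝ := ((2 : ℝ) ^ M)⁻¹

/-- The scales `r_j = R^{2^j δ}`, for `j = 0, …, M`; thus `r_0 = R^δ` and `r_M = R`. -/
def radius (M : ℕ) (R : ℝ) (j : ℕ) : ℝ := R ^ ((2 : ℝ) ^ j * delta M)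

/-- The dilation factor `R^{2(j+1)δ²}` attached to squares of side length `r_j / R`. -/
def inflation (M : ℕ) (R : ℝ) (j : ℕ) : ℝ := R ^ (2 * ((j : ℝ) + 1) * delta M ^ 2)

/-! ### Arcs of the unit circle and nested families of caps -/

/-- The unit vector with polar angle `α`. -/
def unitVec (α : ℝ) : Plane := !₂[Real.cos α, Real.sin α]

/-- A half-open arc of the unit circle, given by its initial angle and its length. -/
structure Arc where
  start : ℝ
  length : ℝ
  length_pos : 0 < length
  length_le : length ≤ 2 * Real.pi

/-- The points of an arc. -/
def Arc.carrier (θ : Arc) : Set Plane := unitVec '' Ico θ.start (θ.start + θ.length)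

/-- The polar angle of the centre of an arc; it is the direction of the arc. -/
def Arc.mid (θ : Arc) : ℝ := θ.start + θ.length / 2

/-- The whole unit circle. -/
def Arc.circle : Arc where
  start := 0
  length := 2 * Real.pi
  length_pos := Real.two_pi_pos
  length_le := le_rfl

/-- The unit circle is divided into `r_0⁻¹`-caps, each of these into `r_1⁻¹`-caps, and so on down
to the `r_{M-1}⁻¹ = R^{-1/2}`-caps. An `r⁻¹`-cap is an arc whose length is comparable to `r⁻¹`,
with comparability constant `K`. -/
structure CapSystem (M : ℕ) (R K : ℝ) where
  caps : ℕ → Finset Arc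
  le_length : ∀ j < M, ∀ θ ∈ caps j, K⁻¹ * (radius M R j)⁻¹ ≤ θ.length
  length_le : ∀ j < M, ∀ θ ∈ caps j, θ.length ≤ K * (radius M R j)⁻¹
  disjoint : ∀ j < M, ∀ θ ∈ caps j, ∀ θ' ∈ caps j, θ ≠ θ' → Disjoint θ.carrier θ'.carrier
  cover : ∀ j < M, ∀ x : Plane, ‖x‖ = 1 → ∃ θ ∈ caps j, x ∈ θ.carrier
  nested : ∀ j, j + 1 < M → ∀ θ ∈ caps (j + 1), ∃ θ' ∈ caps j, θ.carrier ⊆ θ'.carrier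

variable {M : ℕ} {R K : ℝ}

/-- The caps `θ_{k-1}`, with the convention that `θ_{-1}` is the whole circle. -/
def CapSystem.parentCaps (𝒞 : CapSystem M R K) : ℕ → Finset Arc
  | 0 => {Arc.circle}
  | k + 1 => 𝒞.caps k

open Classical in
/-- The caps `θ_j` of generation `j` that are contained in the arc `θ'`. -/
def CapSystem.capsIn (𝒞 : CapSystem M R K) (j : ℕ) (θ' : Arc) : Finset Arc :=
  (𝒞.caps j).filter fun θ => θ.carrier ⊆ θ'.carrier

/-- The frequency cutoffs `ψ_θ` at frequency scale `R`, one for each `R^{-1/2}`-cap `θ`: smooth,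
non-negative, with sum at most one (they are some of the members of a partition of unity), the one
of `θ` being supported in a rectangle of size comparable to `R^{1/2} × R` which starts
at the origin and has the direction of `θ` as its long axis. -/
structure Cutoffs (𝒞 : CapSystem M R K) where
  toFun : Arc → Plane → ℝ
  smooth : ∀ θ ∈ 𝒞.caps (M - 1), ContDiff ℝ ∞ (toFun θ)
  nonneg : ∀ θ ∈ 𝒞.caps (M - 1), ∀ ξ, 0 ≤ toFun θ ξ
  sum_le_one : ∀ ξ, ∑ θ ∈ 𝒞.caps (M - 1), toFun θ ξ ≤ 1
  support_subset : ∀ θ ∈ 𝒞.caps (M - 1), ∀ ξ, toFun θ ξ ≠ 0 →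
    0 ≤ inner ℝ ξ (unitVec θ.mid) ∧ inner ℝ ξ (unitVec θ.mid) ≤ K * R ∧
      |inner ℝ ξ (unitVec (θ.mid + Real.pi / 2))| ≤ K * Real.sqrt R

/-! ### Dyadic squares and tubes -/

/-- The half-open dyadic square of side length `2 ^ scale` whose lower left corner
is `2 ^ scale • idx`. -/
structure DyadicSquare where
  scale : ℤ
  idx : Fin 2 → ℤ

/-- The side length of a dyadic square. -/
def DyadicSquare.side (Q : DyadicSquare) : ℝ := (2 : ℝ) ^ Q.scale

/-- The points of a dyadic square. -/
def DyadicSquare.carrier (Q : DyadicSquare) : Set Plane :=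
  {x | ∀ i, (Q.idx i : ℝ) * Q.side ≤ x i ∧ x i < ((Q.idx i : ℝ) + 1) * Q.side}

/-- The centre of a dyadic square. -/
def DyadicSquare.center (Q : DyadicSquare) : Plane :=
  WithLp.toLp 2 fun i => ((Q.idx i : ℝ) + 1 / 2) * Q.side

/-- The dilation `lam Q` of a dyadic square by the factor `lam` from its centre. -/
def DyadicSquare.dilate (Q : DyadicSquare) (lam : ℝ) : Set Plane :=
  {x | ∀ i, Q.center i - lam * Q.side / 2 ≤ x i ∧ x i < Q.center i + lam * Q.side / 2}

/-- The collection `𝒟_{r_j/R}`, where `r_j / R` is replaced by the largest power of two that does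
not exceed it. -/
def squares (M : ℕ) (R : ℝ) (j : ℕ) : Set DyadicSquare :=
  {Q | Q.scale = Int.log 2 (radius M R j / R)}

/-- The `w × l` tube with centre `c` whose long axis (of length `l`) has polar angle `α`. -/
def tube (c : Plane) (α w l : ℝ) : Set Plane :=
  {x | |inner ℝ (x - c) (unitVec α)| ≤ l / 2 ∧
    |inner ℝ (x - c) (unitVec (α + Real.pi / 2))| ≤ w / 2}

/-! ### Bad caps -/

/-- The cap `θ` of generation `j` is bad for `Q ∈ 𝒟_{r_j/R}`, where `Q' ∈ 𝒟_{r_{j+1}/R}` is the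
square containing `Q`: the `R^δ`-dilate of the `r_j/R × r_{j+1}/R` tube in direction `θ` centred at
the centre of `Q` has measure greater than `R^{10δ} (r_j/r_{j+1})^{min(t,1)}` for the measure `ν`
conditioned on the inflated square `R^{2(j+2)δ²} Q'`. -/
def IsBad (M : ℕ) (R : ℝ) (ν : Measure Plane) (t : ℝ) (j : ℕ) (θ : Arc)
    (Q Q' : DyadicSquare) : Prop :=
  R ^ (10 * delta M) * (radius M R j / radius M R (j + 1)) ^ min t 1 <
    (cond ν (Q'.dilate (inflation M R (j + 1)))).real
      (tube Q.center θ.mid (R ^ delta M * (radius M R j / R))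
        (R ^ delta M * (radius M R (j + 1) / R)))

open Classical in
/-- The set `Θ_j(Q)` of the caps of generation `j` that are bad for the square of `𝒟_{r_j/R}`
containing `Q`; it is empty for `j = M`. -/
def badCaps (𝒞 : CapSystem M R K) (ν : Measure Plane) (t : ℝ) (j : ℕ) (Q : DyadicSquare) :
    Finset Arc :=
  if j < M then
    (𝒞.caps j).filter fun θ => ∃ Qj ∈ squares M R j, ∃ Qj' ∈ squares M R (j + 1),
      Q.carrier ⊆ Qj.carrier ∧ Qj.carrier ⊆ Qj'.carrier ∧ IsBad M R ν t j θ Qj Qj'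
  else ∅

open Classical in
/-- The set `Θ_{=j}(Q)`, for `Q ∈ 𝒟_{r_k/R}` and `k < j`: the caps of `Θ_j(Q)` disjoint from all
the caps in `Θ_k(Q), …, Θ_{j-1}(Q)`. -/
def newBadCaps (𝒞 : CapSystem M R K) (ν : Measure Plane) (t : ℝ) (k j : ℕ) (Q : DyadicSquare) :
    Finset Arc :=
  (badCaps 𝒞 ν t j Q).filter fun θ =>
    ∀ i ∈ Finset.Ico k j, ∀ θ' ∈ badCaps 𝒞 ν t i Q, Disjoint θ.carrier θ'.carrier

/-! ### The functions -/

/-- The Fourier transform `∫ e^{-2πi x·ξ} dμ(x)` of a measure. -/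
def measureFourier (μ : Measure Plane) (ξ : Plane) : ℂ :=
  ∫ x, Complex.exp (-(2 * Real.pi * inner ℝ x ξ : ℝ) * Complex.I) ∂μ

/-- The arc length measure on the circle of radius `ρ` about the origin, normalized to be a
probability measure. -/
def circleMeasure (ρ : ℝ) : Measure Plane :=
  (ENNReal.ofReal (2 * Real.pi))⁻¹ •
    (volume.restrict (Ioc 0 (2 * Real.pi))).map fun α => ρ • unitVec α

/-- The inverse Fourier transform `((χ μ̂ dσ_ρ) * ψ)^∨`. -/
def localizedExtension (χ : Plane → ℝ) (μ : Measure Plane) (ρ : ℝ) (ψ : Plane → ℝ) : Plane → ℂ :=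
  𝓕⁻ fun ξ : Plane => ∫ η, (χ η : ℂ) * measureFourier μ η * (ψ (ξ - η) : ℂ) ∂circleMeasure ρ

/-- `F_{θ'}`, the sum of the functions `F_θ = ((ψ_θ μ̂ dσ_ρ) * ψ)^∨` over the `R^{-1/2}`-caps `θ`
contained in `θ'`. -/
def capPiece {𝒞 : CapSystem M R K} (χ : Cutoffs 𝒞) (μ : Measure Plane) (ρ : ℝ) (ψ : Plane → ℝ)
    (θ' : Arc) (y : Plane) : ℂ :=
  ∑ θ ∈ 𝒞.capsIn (M - 1) θ', localizedExtension (χ.toFun θ) μ ρ ψ y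

open Classical in
/-- The function `F_{Q,θ'}` for `Q ∈ 𝒟_{r_k/R}` and a cap `θ' = θ_{k-1}`, where `0 ≤ k ≤ M`:
`F_{θ'}` minus the sum of `F_{θ_k}` over the bad caps `θ_k ∈ Θ_k(Q)` contained in `θ'`, minus the
sum over `k < j < M` of the sums of `F_{θ_j}` over the caps `θ_j ∈ Θ_{=j}(Q)` contained in `θ'`. -/
def goodPiece {𝒞 : CapSystem M R K} (χ : Cutoffs 𝒞) (μ ν : Measure Plane) (t ρ : ℝ)
    (ψ : Plane → ℝ) (k : ℕ) (Q : DyadicSquare) (θ' : Arc) (y : Plane) : ℂ :=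
  capPiece χ μ ρ ψ θ' y
    - ∑ θ ∈ (badCaps 𝒞 ν t k Q).filter (fun θ => θ.carrier ⊆ θ'.carrier), capPiece χ μ ρ ψ θ y
    - ∑ j ∈ Finset.Ico (k + 1) M,
        ∑ θ ∈ (newBadCaps 𝒞 ν t k j Q).filter (fun θ => θ.carrier ⊆ θ'.carrier),
          capPiece χ μ ρ ψ θ y

/-- The weighted local `L²` mass `ν(S) ∫ |F|² dm_S`, where `m_S` is the normalized Lebesgue measure
on `S`. -/
def weightedMass (ν : Measure Plane) (F : Plane → ℂ) (S : Set Plane) : ℝ≥0∞ :=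
  ν S * ∫⁻ y, ‖F y‖ₑ ^ 2 ∂(cond volume S)

end BallInflation

end

open BallInflation

/-! Let `Q` be a square of side about `r_k/R` inside `Q'`. The function attached to `Q` and `θ'` is
the sum, over the children `θ` of `θ'` that are good for `Q`, of the functions attached to `Q'` and
`θ` (`goodPiece_eq_sum`): a bad child is removed entirely, and inside a good child the caps removed
later are the same for `Q` and for `Q'`.

The Fourier transform of the piece of `θ` lies within `O(R/r_k)` of `ρ e_θ`. By the curvature of the
circle its extent in the direction `e_θ` is only `O(R/r_k²) = O(R/r_{k+1})`
(`Cutoffs.frequency_mem`). This has two consequences, combined in `exists_local_estimate`. At the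
spatial scale of `Q` the pieces are almost orthogonal, since boundedly many caps of length about
`1/r_k` have directions within `O(1/r_k)` of each other. And each piece is essentially constant on
translates of an `r_k/R × r_{k+1}/R` tube in direction `θ`, so its square on `Q` is dominated by a
mean over a slightly enlarged tube centred at `Q`, up to rapidly decaying tails.

Next sum over `Q` with the weights `ν` and exchange sum and integral. For fixed `θ` and `y`, one
needs the total `ν`-mass of the squares for which `θ` is good and whose tube contains `y`. These
tubes are parallel and share `y`, so all the squares lie in the `R^δ`-dilate of the tube of any
single one of them, and goodness of `θ` for that one square bounds the mass
(`tsum_good_measure_le`). This gives the power `min t 1`; the exponent drops by one because the tube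
has area `r_k/r_{k+1}` times that of a square of side `r_{k+1}/R`.

The tubes are enlarged by `X = R^{δ²}`, which makes the tails `O(X^{-m})` for every `m`. The
inflation factor grows by `X²` per generation, which leaves room for one `X` and for absolute
constants once `20 ≤ X`. If `X < 20`, then `R` is bounded in terms of `M`; if `M < 3`, then `δ ≥
1/4`. In both cases the crude bound `tsum_weightedMass_le_pow`, losing `R^7`, is enough. -/

namespace BallInflation

open scoped SchwartzMap

/-! ### Orthogonality, local constancy and tails for functions with restricted Fourier support. -/

section FourierAnalysis

variable {V : Type*} [NormedAddCommGroup V] [InnerProductSpace ℝ V] [FiniteDimensional ℝ V]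
  [MeasurableSpace V] [BorelSpace V]

theorem continuous_fourierInv {g : V → ℂ} (hg : Integrable g) : Continuous (𝓕⁻ g) := by
  have h : Continuous (𝓕 g) :=
    VectorFourier.fourierIntegral_continuous Real.continuous_fourierChar
      (by exact continuous_inner) hg
  have h2 : 𝓕⁻ g = fun x => 𝓕 g (-x) := by
    ext x; exact Real.fourierInv_eq_fourier_neg g x
  rw [h2]; exact h.comp continuous_neg

theorem fourierInv_finsetSum {ι : Type*} (s : Finset ι) (g : ι → V → ℂ)
    (hg : ∀ i ∈ s, Integrable (g i)) (x : V) :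
    𝓕⁻ (fun ξ => ∑ i ∈ s, g i ξ) x = ∑ i ∈ s, 𝓕⁻ (g i) x := by
  simp only [Real.fourierInv_eq, Finset.smul_sum]
  rw [integral_finsetSum]
  intro i hi
  have := (Real.fourierIntegral_convergent_iff (μ := volume) (f := g i) (-x)).2 (hg i hi)
  simpa using this

/-- Testing an inverse Fourier transform, composed with an affine map, against a modulated
integrable function. -/
theorem integral_modulate_mul_fourierInv {g Φ : V → ℂ} (hg : Integrable g) (hΦ : Integrable Φ)
    {A B : V →L[ℝ] V} (hAB : ∀ y ζ, inner ℝ (B y) ζ = inner ℝ y (A ζ)) (x v : V) :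
    ∫ y, Real.fourierChar (-inner ℝ y v) • (Φ y * 𝓕⁻ g (x - B y)) =
      ∫ ζ, Real.fourierChar (inner ℝ ζ x) • (g ζ * 𝓕 Φ (A ζ + v)) := by
  have key : ∀ y ζ, Real.fourierChar (-inner ℝ y v) •
      (Φ y * (Real.fourierChar (inner ℝ ζ (x - B y)) • g ζ)) =
      Real.fourierChar (inner ℝ ζ x) •
        (g ζ * (Real.fourierChar (-inner ℝ y (A ζ + v)) • Φ y)) := by
    intro y ζ
    have e1 : -inner ℝ y v + inner ℝ ζ (x - B y)
        = inner ℝ ζ x + -inner ℝ y (A ζ + v) := by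
      rw [inner_sub_right, inner_add_right, ← hAB, real_inner_comm ζ (B y)]; ring
    have e2 := congrArg Real.fourierChar e1
    simp only [AddChar.map_add_eq_mul] at e2
    have e3 := congrArg (fun z : Circle => (z : ℂ)) e2
    simp only [Circle.coe_mul] at e3
    simp only [Circle.smul_def, smul_eq_mul]
    linear_combination (Φ y * g ζ) * e3
  simp only [Real.fourierInv_eq, Real.fourier_eq, ← integral_const_mul]
  simp only [Circle.smul_def, ← integral_smul]
  simp only [← Circle.smul_def, key]
  apply integral_integral_swap
  have h1 : Integrable (fun p : V × V => Φ p.1 * g p.2) (volume.prod volume) := hΦ.mul_prod hg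
  have h2 : Continuous fun p : V × V => ((Real.fourierChar (inner ℝ p.2 x) : ℂ) *
      (Real.fourierChar (-inner ℝ p.1 (A p.2 + v)) : ℂ)) := by
    have := Real.continuous_fourierChar
    fun_prop
  have h3 := h1.bdd_mul (c := 1) h2.aestronglyMeasurable (Filter.Eventually.of_forall fun p => by
    rw [norm_mul, Circle.norm_coe, Circle.norm_coe, one_mul])
  refine h3.congr (Filter.Eventually.of_forall fun p => ?_)
  simp only [Circle.smul_def, smul_eq_mul, Function.uncurry]
  ring

theorem lintegral_enorm_sq_fourier (h : 𝓢(V, ℂ)) :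
    ∫⁻ ξ, ‖𝓕 h ξ‖ₑ ^ 2 = ∫⁻ x, ‖h x‖ₑ ^ 2 := by
  have conv : ∀ f : 𝓢(V, ℂ), ∫⁻ x, ‖f x‖ₑ ^ 2 = ENNReal.ofReal (∫ x, ‖f x‖ ^ 2) := by
    intro f
    rw [ofReal_integral_eq_lintegral_ofReal]
    · refine lintegral_congr fun x => ?_
      rw [ENNReal.ofReal_pow (norm_nonneg _), ofReal_norm]
    · exact (f.memLp 2).integrable_norm_pow two_ne_zero
    · exact Filter.Eventually.of_forall fun x => by positivity
  rw [conv, conv, SchwartzMap.integral_norm_sq_fourier]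

/-- Cauchy-Schwarz for a finite sum with at most `m` nonzero terms. -/
theorem enorm_sum_sq_le {ι E : Type*} [NormedAddCommGroup E] (s : Finset ι) (f : ι → E) (m : ℕ)
    [DecidablePred fun i => f i ≠ 0]
    (hm : (s.filter fun i => f i ≠ 0).card ≤ m) :
    ‖∑ i ∈ s, f i‖ₑ ^ 2 ≤ m * ∑ i ∈ s, ‖f i‖ₑ ^ 2 := by
  have h1 : ‖∑ i ∈ s, f i‖ ^ 2 ≤ m * ∑ i ∈ s, ‖f i‖ ^ 2 := by
    rw [← Finset.sum_filter_ne_zero]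
    calc ‖∑ i ∈ s with f i ≠ 0, f i‖ ^ 2 ≤ (∑ i ∈ s with f i ≠ 0, ‖f i‖) ^ 2 := by
          gcongr; exact norm_sum_le _ _
      _ ≤ (s.filter fun i => f i ≠ 0).card * ∑ i ∈ s with f i ≠ 0, ‖f i‖ ^ 2 :=
          sq_sum_le_card_mul_sum_sq
      _ ≤ m * ∑ i ∈ s, ‖f i‖ ^ 2 := by
          gcongr
          exact Finset.filter_subset _ _
  have h2 := ENNReal.ofReal_le_ofReal h1
  rw [ENNReal.ofReal_mul (by positivity), ENNReal.ofReal_sum_of_nonneg (fun i _ => by positivity),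
    ENNReal.ofReal_natCast, ENNReal.ofReal_pow (norm_nonneg _), ofReal_norm] at h2
  simpa only [ENNReal.ofReal_pow (norm_nonneg _), ofReal_norm] using h2

open Classical in
/-- Almost orthogonality of functions whose Fourier transforms overlap boundedly. -/
theorem lintegral_enorm_sum_sq_le {ι : Type*} (s : Finset ι) (h : ι → 𝓢(V, ℂ)) (m : ℕ)
    (hm : ∀ ξ, (s.filter fun i => 𝓕 (h i) ξ ≠ 0).card ≤ m) :
    ∫⁻ x, ‖∑ i ∈ s, h i x‖ₑ ^ 2 ≤ m * ∑ i ∈ s, ∫⁻ x, ‖h i x‖ₑ ^ 2 := by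
  have e1 : ∀ x, ∑ i ∈ s, h i x = (∑ i ∈ s, h i) x := fun x => by simp
  have e2 : ∀ ξ, 𝓕 (∑ i ∈ s, h i) ξ = ∑ i ∈ s, 𝓕 (h i) ξ := fun ξ => by
    have : 𝓕 (∑ i ∈ s, h i) = ∑ i ∈ s, 𝓕 (h i) :=
      map_sum (FourierTransform.fourierCLM ℂ 𝓢(V, ℂ)) h s
    rw [this]; simp
  simp_rw [e1]
  rw [← lintegral_enorm_sq_fourier]
  simp_rw [e2, ← lintegral_enorm_sq_fourier (h _)]
  calc _ ≤ ∫⁻ ξ, m * ∑ i ∈ s, ‖𝓕 (h i) ξ‖ₑ ^ 2 :=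
        lintegral_mono fun ξ => enorm_sum_sq_le s _ m (hm ξ)
    _ = _ := by
        have hmeas : ∀ i, Measurable fun ξ => ‖𝓕 (h i) ξ‖ₑ ^ 2 := fun i =>
          ((𝓕 (h i)).continuous.measurable.enorm).pow_const 2
        rw [lintegral_const_mul _ (Finset.measurable_fun_sum _ fun i _ => hmeas i),
          lintegral_finsetSum _ fun i _ => hmeas i]

/-- Local `L²` orthogonality at scale `ℓ`, with a Schwartz weight. -/
theorem lintegral_sum_fourierInv_mul_sq_le {ι : Type*} (s : Finset ι) (g : ι → 𝓢(V, ℂ))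
    (η : 𝓢(V, ℂ)) (hη : ∀ ξ, 𝓕 η ξ ≠ 0 → ‖ξ‖ ≤ 1) (c : V) (ℓ : ℝ) (m : ℕ)
    (hm : ∀ ξ, ∀ s' ⊆ s, (∀ i ∈ s', ∃ ζ, g i ζ ≠ 0 ∧ ‖ξ - ℓ • ζ‖ ≤ 1) → s'.card ≤ m) :
    ∫⁻ y, ‖∑ i ∈ s, 𝓕⁻ (g i : V → ℂ) (c + ℓ • y)‖ₑ ^ 2 * ‖η y‖ₑ ^ 2 ≤
      m * ∑ i ∈ s, ∫⁻ y, ‖𝓕⁻ (g i : V → ℂ) (c + ℓ • y)‖ₑ ^ 2 * ‖η y‖ₑ ^ 2 := by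
  classical
  have hG : ∀ i, (fun y => 𝓕⁻ (g i) (c + ℓ • y)).HasTemperateGrowth := by
    intro i
    have h1 := (𝓕⁻ (g i)).hasTemperateGrowth
    have h2 : (fun y : V => c + ℓ • y).HasTemperateGrowth := by fun_prop
    exact h1.comp h2
  let h : ι → 𝓢(V, ℂ) := fun i =>
    SchwartzMap.smulLeftCLM ℂ (fun y => 𝓕⁻ (g i) (c + ℓ • y)) η
  have hh : ∀ i y, h i y = 𝓕⁻ (g i : V → ℂ) (c + ℓ • y) * η y := by
    intro i y
    simp only [h]
    rw [SchwartzMap.smulLeftCLM_apply_apply (hG i), smul_eq_mul, SchwartzMap.fourierInv_coe]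
  have key := lintegral_enorm_sum_sq_le s h m ?_
  · simp only [hh, ← Finset.sum_mul, enorm_mul, mul_pow] at key
    exact key
  · intro ξ
    refine hm ξ _ (Finset.filter_subset _ _) fun i hi => ?_
    by_contra hcon
    push Not at hcon
    refine (Finset.mem_filter.1 hi).2 ?_
    -- With `A = B = -ℓ`, this writes the Fourier transform of `h i` at `ξ` as an integral of `g i
    -- ζ` against `𝓕 η (ξ - ℓ • ζ)`, which vanishes if no frequency of `g i` satisfies `‖ξ - ℓ • ζ‖
    -- ≤ 1`.
    have := integral_modulate_mul_fourierInv (g i).integrable η.integrable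
      (A := -(ℓ • ContinuousLinearMap.id ℝ V)) (B := -(ℓ • ContinuousLinearMap.id ℝ V))
      (by intro y ζ; simp [inner_smul_left, inner_smul_right]) c ξ
    have hz : ∀ ζ, g i ζ * 𝓕 (η : V → ℂ) ((-(ℓ • ContinuousLinearMap.id ℝ V)) ζ + ξ) = 0 := by
      intro ζ
      by_cases h0 : g i ζ = 0
      · simp [h0]
      · have h1 := hcon ζ h0
        have h2 : 𝓕 η (ξ - ℓ • ζ) = 0 := by
          by_contra h3
          exact absurd (hη _ h3) (not_le.2 h1)
        rw [SchwartzMap.fourier_coe] at h2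
        simp only [_root_.neg_apply, _root_.smul_apply,
          ContinuousLinearMap.id_apply]
        rw [show -(ℓ • ζ) + ξ = ξ - ℓ • ζ by abel, h2, mul_zero]
    simp only [hz, smul_zero, integral_zero] at this
    rw [SchwartzMap.fourier_coe, Real.fourier_eq, ← this]
    congr 1
    ext y
    rw [hh]
    simp only [_root_.neg_apply, _root_.smul_apply,
          ContinuousLinearMap.id_apply, sub_neg_eq_add]
    rw [mul_comm (η y)]

/-- Cauchy–Schwarz for the splitting `φ f = φ^{1/2} · (φ^{1/2} f)`. -/
theorem lintegral_mul_sq_le {α : Type*} [MeasurableSpace α] (μ : Measure α) {φ f : α → ℝ≥0∞}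
    (hφ : AEMeasurable φ μ) (hf : AEMeasurable f μ) :
    (∫⁻ a, φ a * f a ∂μ) ^ 2 ≤ (∫⁻ a, φ a ∂μ) * ∫⁻ a, φ a * f a ^ 2 ∂μ := by
  have h := ENNReal.lintegral_mul_le_Lp_mul_Lq μ Real.HolderConjugate.two_two
    (hφ.pow_const (1 / 2 : ℝ)) ((hφ.pow_const (1 / 2 : ℝ)).mul hf)
  have e : ∀ a, φ a ^ (1 / 2 : ℝ) * φ a ^ (1 / 2 : ℝ) = φ a := fun a => by
    rw [← ENNReal.rpow_add_of_nonneg _ _ (by norm_num) (by norm_num)]; norm_num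
  have e1 : ∀ a, (φ a ^ (1 / 2 : ℝ)) ^ (2 : ℝ) = φ a := fun a => by
    rw [← ENNReal.rpow_mul]; norm_num
  simp only [Pi.mul_apply, ← mul_assoc, e, ENNReal.mul_rpow_of_nonneg _ _ zero_le_two, e1] at h
  simp only [ENNReal.rpow_two] at h
  refine (pow_le_pow_left' h 2).trans (le_of_eq ?_)
  rw [mul_pow]
  simp only [← ENNReal.rpow_natCast, ← ENNReal.rpow_mul]
  norm_num

/-- A function with Fourier support in the set where `𝓕 Φ (A · - A ξ₀) = 1` is
pointwise controlled by its average with weight `|Φ|`. -/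
theorem enorm_fourierInv_sq_le {g : V → ℂ} (hg : Integrable g) (Φ : 𝓢(V, ℂ))
    {A B : V →L[ℝ] V} (hAB : ∀ y ζ, inner ℝ (B y) ζ = inner ℝ y (A ζ)) (ξ₀ : V)
    (hΦ : ∀ ζ, g ζ ≠ 0 → 𝓕 Φ (A ζ - A ξ₀) = 1) (x : V) :
    ‖𝓕⁻ g x‖ₑ ^ 2 ≤ (∫⁻ y, ‖Φ y‖ₑ) * ∫⁻ y, ‖Φ y‖ₑ * ‖𝓕⁻ g (x - B y)‖ₑ ^ 2 := by
  -- The modulation by `-A ξ₀` centres the frequencies, so that the multiplier is `1` wherever `g ≠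
  -- 0`: the right side is then `𝓕⁻ g x` itself, a reproducing formula.
  have h := integral_modulate_mul_fourierInv hg Φ.integrable hAB x (-A ξ₀)
  have h1 : ∀ ζ, g ζ * 𝓕 (Φ : V → ℂ) (A ζ + -A ξ₀) = g ζ := by
    intro ζ
    by_cases h0 : g ζ = 0
    · simp [h0]
    · have := hΦ ζ h0
      rw [SchwartzMap.fourier_coe, sub_eq_add_neg] at this
      rw [this, mul_one]
  simp only [h1, ← Real.fourierInv_eq] at h
  have hcont := continuous_fourierInv hg
  refine le_trans ?_ (lintegral_mul_sq_le volume Φ.continuous.measurable.enorm.aemeasurable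
    (hcont.comp (by fun_prop : Continuous fun y => x - B y)).measurable.enorm.aemeasurable)
  rw [← h]
  gcongr
  refine (enorm_integral_le_lintegral_enorm _).trans (le_of_eq ?_)
  refine lintegral_congr fun y => ?_
  rw [← enorm_mul]
  simp only [Circle.smul_def, smul_eq_mul, enorm_mul]
  rw [show ∀ z : Circle, ‖(z : ℂ)‖ₑ = 1 from fun z => by
    rw [← ofReal_norm, Circle.norm_coe, ENNReal.ofReal_one], one_mul]

/-- Markov's inequality with the `m`-th moment as constant: `1 ≤ (‖y‖ / X)^m` on the tail. -/
theorem exists_lintegral_tail_le (f : 𝓢(V, ℂ)) (m : ℕ) :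
    ∃ C : ℝ, 0 ≤ C ∧ ∀ X : ℝ, 0 < X →
      ∫⁻ y in {y | X < ‖y‖}, ‖f y‖ₑ ≤ ENNReal.ofReal (C * (X ^ m)⁻¹) := by
  refine ⟨∫ y, ‖y‖ ^ m * ‖f y‖, integral_nonneg fun y => by positivity, fun X hX => ?_⟩
  have hint : Integrable fun y : V => ‖y‖ ^ m * ‖f y‖ := f.integrable_pow_mul volume m
  rw [mul_comm, ENNReal.ofReal_mul (by positivity), ofReal_integral_eq_lintegral_ofReal hint
    (Filter.Eventually.of_forall fun y => by positivity), ← lintegral_const_mul' _ _ (by simp)]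
  refine (setLIntegral_mono_ae' (measurableSet_lt measurable_const measurable_norm)
    (Filter.Eventually.of_forall fun y hy => ?_)).trans (setLIntegral_le_lintegral _ _)
  rw [← ENNReal.ofReal_mul (by positivity), ← ofReal_norm]
  apply ENNReal.ofReal_le_ofReal
  have : 1 ≤ (X ^ m)⁻¹ * ‖y‖ ^ m := by
    rw [← inv_pow, ← mul_pow]
    apply one_le_pow₀
    rw [← div_eq_inv_mul, one_le_div hX]
    exact le_of_lt hy
  nlinarith [norm_nonneg (f y)]

theorem exists_lintegral_sq_tail_le (f : 𝓢(V, ℂ)) (m : ℕ) :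
    ∃ C : ℝ, 0 ≤ C ∧ ∀ X : ℝ, 0 < X →
      ∫⁻ y in {y | X < ‖y‖}, ‖f y‖ₑ ^ 2 ≤ ENNReal.ofReal (C * (X ^ m)⁻¹) := by
  obtain ⟨C, hC, h⟩ := exists_lintegral_tail_le f m
  obtain ⟨D, hDpos, hD⟩ := f.decay 0 0
  simp only [pow_zero, one_mul, norm_iteratedFDeriv_zero] at hD
  refine ⟨D * C, by positivity, fun X hX => ?_⟩
  rw [mul_assoc, ENNReal.ofReal_mul hDpos.le]
  refine le_trans ?_ (mul_le_mul_right (h X hX) _)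
  rw [← lintegral_const_mul' _ _ (by simp)]
  refine lintegral_mono fun y => ?_
  rw [pow_two]
  gcongr
  rw [← ofReal_norm]
  exact ENNReal.ofReal_le_ofReal (hD y)

theorem lintegral_enorm_ne_top (f : 𝓢(V, ℂ)) : ∫⁻ y, ‖f y‖ₑ ≠ ⊤ :=
  (f.integrable (μ := volume)).2.ne

theorem exists_fourier_eq_one_on_ball (r : ℝ) :
    ∃ Φ : 𝓢(V, ℂ), ∀ ξ, ‖ξ‖ ≤ r → 𝓕 Φ ξ = 1 := by
  -- The maximum keeps the inner radius positive for every real `r`.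
  let b : ContDiffBump (0 : V) := ⟨max r 1, max r 1 + 1, by positivity, by linarith⟩
  have hs : HasCompactSupport fun x => (b x : ℂ) :=
    b.hasCompactSupport.comp_left Complex.ofReal_zero
  have hd : ContDiff ℝ ∞ fun x => (b x : ℂ) := Complex.ofRealCLM.contDiff.comp b.contDiff
  refine ⟨𝓕⁻ (hs.toSchwartzMap hd), fun ξ hξ => ?_⟩
  rw [FourierTransform.fourier_fourierInv_eq]
  have : b ξ = 1 := b.one_of_mem_closedBall (by
    simp only [Metric.mem_closedBall, dist_zero_right]
    exact hξ.trans (le_max_left _ _))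
  simp [this]

/-- This is the substitute for the indicator of a ball. Multiplying by it blurs frequencies by at
most `1`, at the price of tails in space. -/
theorem exists_schwartz_band_limited :
    ∃ η : 𝓢(V, ℂ), (∀ ξ, 𝓕 η ξ ≠ 0 → ‖ξ‖ ≤ 1) ∧ ∀ y, ‖y‖ ≤ 1 → 1 ≤ ‖η y‖ := by
  -- With the support in radius `1/6` and `‖y‖ ≤ 1`, every phase is at most `2π/6 = π/3`, so its
  -- cosine is at least `1/2` and there is no cancellation.
  let b : ContDiffBump (0 : V) := ⟨1 / 12, 1 / 6, by norm_num, by norm_num⟩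
  have hs : HasCompactSupport fun x => (b x : ℂ) :=
    b.hasCompactSupport.comp_left Complex.ofReal_zero
  have hd : ContDiff ℝ ∞ fun x => (b x : ℂ) := Complex.ofRealCLM.contDiff.comp b.contDiff
  have hI : 0 < ∫ x, b x := b.integral_pos
  set I := ∫ x, b x with hIdef
  have hbint : Integrable (fun x => b x) := b.integrable
  let φ := hs.toSchwartzMap hd
  refine ⟨((2 / I : ℝ) : ℂ) • 𝓕⁻ φ, fun ξ hξ => ?_, fun y hy => ?_⟩
  · rw [FourierTransform.fourier_smul, FourierTransform.fourier_fourierInv_eq] at hξ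
    have : b ξ ≠ 0 := by
      intro h0
      apply hξ
      simp [φ, h0]
    have : ξ ∈ Function.support b := this
    rw [b.support_eq] at this
    simp only [Metric.mem_ball, dist_zero_right, b] at this
    linarith
  · have h1 : (𝓕⁻ φ) y = ∫ ξ, Real.fourierChar (inner ℝ ξ y) • (b ξ : ℂ) := by
      rw [SchwartzMap.fourierInv_coe, Real.fourierInv_eq]; rfl
    have hre : I / 2 ≤ ((𝓕⁻ φ) y).re := by
      rw [h1]
      have hint : Integrable fun ξ => Real.fourierChar (inner ℝ ξ y) • (b ξ : ℂ) := by
        have := (Real.fourierIntegral_convergent_iff (μ := volume) (f := fun ξ => (b ξ : ℂ))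
          (-y)).2 hbint.ofReal
        simpa using this
      have hri : Integrable fun ξ => (Real.fourierChar (inner ℝ ξ y) • (b ξ : ℂ)).re := hint.re
      have : (∫ ξ, Real.fourierChar (inner ℝ ξ y) • (b ξ : ℂ)).re =
          ∫ ξ, (Real.fourierChar (inner ℝ ξ y) • (b ξ : ℂ)).re :=
        (integral_re hint).symm
      rw [this, hIdef, ← integral_div]
      refine integral_mono (hbint.div_const 2) hri fun ξ => ?_
      by_cases h0 : b ξ = 0
      · simp [h0]
      · have : ξ ∈ Function.support b := h0
        rw [b.support_eq] at this
        simp only [Metric.mem_ball, dist_zero_right, b] at this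
        have hin : |inner ℝ ξ y| ≤ 1 / 6 := by
          refine (abs_real_inner_le_norm _ _).trans ?_
          nlinarith [norm_nonneg ξ, norm_nonneg y]
        have hcos : 1 / 2 ≤ Real.cos (2 * Real.pi * inner ℝ ξ y) := by
          rw [← Real.cos_pi_div_three, ← Real.cos_abs (2 * Real.pi * _)]
          apply Real.cos_le_cos_of_nonneg_of_le_pi (abs_nonneg _)
          · linarith [Real.pi_pos]
          · rw [abs_mul, abs_of_pos Real.two_pi_pos]
            nlinarith [Real.pi_pos]
        have hre : (Real.fourierChar (inner ℝ ξ y) • (b ξ : ℂ)).re =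
            Real.cos (2 * Real.pi * inner ℝ ξ y) * b ξ := by
          rw [Circle.smul_def, Real.fourierChar_apply, smul_eq_mul, Complex.re_mul_ofReal,
            Complex.exp_ofReal_mul_I_re]
        change b ξ / 2 ≤ _
        rw [hre]
        nlinarith [b.nonneg (x := ξ)]
    have hn : I / 2 ≤ ‖(𝓕⁻ φ) y‖ := hre.trans (Complex.re_le_norm _)
    rw [_root_.smul_apply, norm_smul, Complex.norm_real, Real.norm_of_nonneg (by positivity)]
    calc 1 = 2 / I * (I / 2) := by field_simp
      _ ≤ _ := by gcongr

end FourierAnalysis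

end BallInflation

namespace BallInflation

open scoped SchwartzMap

/-! ### The functions `F_θ` as inverse Fourier transforms of Schwartz functions. -/

section FrequencyPieces

theorem norm_unitVec (α : ℝ) : ‖unitVec α‖ = 1 := by
  rw [EuclideanSpace.norm_eq, Real.sqrt_eq_one]
  simp [unitVec, Fin.sum_univ_two]

theorem continuous_unitVec : Continuous unitVec := by
  unfold unitVec
  refine (PiLp.continuous_toLp 2 _).comp (continuous_pi fun i => ?_)
  fin_cases i
  · exact Real.continuous_cos
  · exact Real.continuous_sin

theorem measurable_smul_unitVec (ρ : ℝ) : Measurable fun α => ρ • unitVec α :=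
  (continuous_unitVec.const_smul ρ).measurable

instance isProbabilityMeasure_circleMeasure (ρ : ℝ) :
    IsProbabilityMeasure (circleMeasure ρ) := by
  constructor
  have h : ENNReal.ofReal (2 * Real.pi) ≠ 0 := by
    simp [Real.pi_pos]
  rw [circleMeasure, Measure.smul_apply, Measure.map_apply (measurable_smul_unitVec ρ)
    MeasurableSet.univ]
  simp only [preimage_univ, Measure.restrict_apply_univ, Real.volume_Ioc, sub_zero, smul_eq_mul]
  exact ENNReal.inv_mul_cancel h ENNReal.ofReal_ne_top

theorem ae_norm_eq_circleMeasure {ρ : ℝ} (hρ : 0 ≤ ρ) : ∀ᵐ η ∂circleMeasure ρ, ‖η‖ = ρ := by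
  refine Measure.ae_smul_measure ?_ _
  rw [ae_map_iff (measurable_smul_unitVec ρ).aemeasurable
    (measurableSet_eq_fun measurable_norm measurable_const)]
  refine Filter.Eventually.of_forall fun α => ?_
  rw [norm_smul, norm_unitVec, mul_one, Real.norm_of_nonneg hρ]

theorem norm_measureFourier_le (μ : Measure Plane) [IsProbabilityMeasure μ] (ξ : Plane) :
    ‖measureFourier μ ξ‖ ≤ 1 := by
  refine (norm_integral_le_of_norm_le_const (C := 1)
    (Filter.Eventually.of_forall fun x => ?_)).trans (by simp)
  rw [← Complex.ofReal_neg, Complex.norm_exp_ofReal_mul_I]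

theorem continuous_measureFourier (μ : Measure Plane) [IsProbabilityMeasure μ] :
    Continuous (measureFourier μ) := by
  unfold measureFourier
  refine continuous_of_dominated (bound := fun _ => 1) (fun ξ => ?_) (fun ξ => ?_)
    (integrable_const _) ?_
  · exact Continuous.aestronglyMeasurable (by fun_prop)
  · exact Filter.Eventually.of_forall fun x => by rw [← Complex.ofReal_neg, Complex.norm_exp_ofReal_mul_I]
  · exact Filter.Eventually.of_forall fun x => by fun_prop

/-- The function `F_θ` is the inverse Fourier transform of a Schwartz function supported near
the part of the circle where the cutoff is nonzero. -/
theorem exists_schwartz_localizedExtension {χ : Plane → ℝ} (hχ : Continuous χ)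
    (hχ0 : ∀ ξ, 0 ≤ χ ξ) (hχ1 : ∀ ξ, χ ξ ≤ 1) (μ : Measure Plane) [IsProbabilityMeasure μ]
    {ρ : ℝ} (hρ : 0 ≤ ρ) {ψ : Plane → ℝ} (hψ : ContDiff ℝ ∞ ψ) (hψc : HasCompactSupport ψ) :
    ∃ g : 𝓢(Plane, ℂ), (∀ y, 𝓕⁻ (g : Plane → ℂ) y = localizedExtension χ μ ρ ψ y) ∧
      (∀ ξ, g ξ ≠ 0 → ∃ η, ‖η‖ = ρ ∧ χ η ≠ 0 ∧ ψ (ξ - η) ≠ 0) ∧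
      ∫⁻ ξ, ‖g ξ‖ₑ ≤ (∫⁻ ξ, ‖ψ ξ‖ₑ) * ∫⁻ η, ‖χ η‖ₑ ∂circleMeasure ρ := by
  set f : Plane → ℂ := fun η => (χ η : ℂ) * measureFourier μ η with hf
  have hfc : Continuous f := (Complex.continuous_ofReal.comp hχ).mul (continuous_measureFourier μ)
  have hfn : ∀ η, ‖f η‖ ≤ ‖χ η‖ := fun η => by
    rw [hf, norm_mul, Complex.norm_real]
    exact mul_le_of_le_one_right (norm_nonneg _) (norm_measureFourier_le μ η)
  have hfb : ∀ η, ‖f η‖ ≤ 1 := fun η => (hfn η).trans (by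
    rw [Real.norm_of_nonneg (hχ0 η)]; exact hχ1 η)
  have hfi : Integrable f (circleMeasure ρ) :=
    Integrable.of_bound hfc.aestronglyMeasurable 1 (Filter.Eventually.of_forall hfb)
  let ψc : Plane → ℂ := fun ξ => (ψ ξ : ℂ)
  have hψcs : HasCompactSupport ψc := hψc.comp_left Complex.ofReal_zero
  have hψcd : ContDiff ℝ ∞ ψc := Complex.ofRealCLM.contDiff.comp hψ
  let g : Plane → ℂ := fun ξ => ∫ η, f η * ψc (ξ - η) ∂circleMeasure ρ
  have hgsupp : ∀ ξ, g ξ ≠ 0 → ∃ η, ‖η‖ = ρ ∧ χ η ≠ 0 ∧ ψ (ξ - η) ≠ 0 := by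
    intro ξ hξ
    by_contra hcon
    push Not at hcon
    apply hξ
    refine integral_eq_zero_of_ae ?_
    filter_upwards [ae_norm_eq_circleMeasure hρ] with η hη
    by_cases h0 : χ η = 0
    · simp [hf, h0]
    · simp [ψc, hcon η hη h0]
  -- By definition `g` is the convolution of `f` with `ψc` relative to the circle measure, and it
  -- inherits the smoothness of `ψc`.
  have hgd : ContDiff ℝ ∞ g :=
    HasCompactSupport.contDiff_convolution_right (ContinuousLinearMap.mul ℝ ℂ) hψcs
      hfi.locallyIntegrable hψcd
  obtain ⟨r, hr⟩ := hψc.isCompact.isBounded.subset_closedBall 0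
  have hgc : HasCompactSupport g := by
    refine HasCompactSupport.of_support_subset_isCompact
      (isCompact_closedBall (0 : Plane) (r + ρ)) fun ξ hξ => ?_
    obtain ⟨η, hη, -, h2⟩ := hgsupp ξ hξ
    have := hr (subset_tsupport _ h2)
    rw [mem_closedBall_zero_iff] at this ⊢
    calc ‖ξ‖ = ‖(ξ - η) + η‖ := by rw [sub_add_cancel]
      _ ≤ _ := (norm_add_le _ _).trans (by linarith)
  refine ⟨hgc.toSchwartzMap hgd, fun y => rfl, hgsupp, ?_⟩
  change ∫⁻ ξ, ‖g ξ‖ₑ ≤ _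
  have hm : Measurable (Function.uncurry fun (ξ η : Plane) => ‖χ η‖ₑ * ‖ψ (ξ - η)‖ₑ) := by
    have h1 := hχ.measurable
    have h2 := hψ.continuous.measurable
    exact (h1.comp measurable_snd).enorm.mul (h2.comp (measurable_fst.sub measurable_snd)).enorm
  calc ∫⁻ ξ, ‖g ξ‖ₑ ≤ ∫⁻ ξ, ∫⁻ η, ‖χ η‖ₑ * ‖ψ (ξ - η)‖ₑ ∂circleMeasure ρ := by
        refine lintegral_mono fun ξ => (enorm_integral_le_lintegral_enorm _).trans ?_
        refine lintegral_mono fun η => ?_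
        rw [enorm_mul]
        gcongr
        · exact enorm_le_iff_norm_le.2 (hfn η)
        · exact le_of_eq (by simp [ψc, ← ofReal_norm])
    _ = ∫⁻ η, (∫⁻ ξ, ‖χ η‖ₑ * ‖ψ (ξ - η)‖ₑ) ∂circleMeasure ρ :=
        lintegral_lintegral_swap hm.aemeasurable
    _ = ∫⁻ η, (∫⁻ ξ, ‖ψ ξ‖ₑ) * ‖χ η‖ₑ ∂circleMeasure ρ := by
        refine lintegral_congr fun η => ?_
        rw [lintegral_const_mul' _ _ (by simp), mul_comm,
          lintegral_sub_right_eq_self (fun ξ => ‖ψ ξ‖ₑ) η]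
    _ = _ := by rw [lintegral_const_mul _ hχ.measurable.enorm]

variable {M : ℕ} {R K : ℝ}

/-- The uniform bound does not depend on the number of caps, because the cutoffs sum to at most one
and the circle measure is a probability measure. It controls the functions in the regions where only
Schwartz tails are available. -/
theorem exists_schwartz_combination {𝒞 : CapSystem M R K} (χ : Cutoffs 𝒞)
    (μ : Measure Plane) [IsProbabilityMeasure μ]
    {ρ : ℝ} (hρ : 0 ≤ ρ) {ψ : Plane → ℝ} (hψ : ContDiff ℝ ∞ ψ) (hψc : HasCompactSupport ψ)
    {s : Finset Arc} (hs : s ⊆ 𝒞.caps (M - 1)) {a : Arc → ℝ} {m : ℝ} (ha : ∀ τ ∈ s, |a τ| ≤ m) :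
    ∃ g : 𝓢(Plane, ℂ),
      (∀ y, 𝓕⁻ (g : Plane → ℂ) y = ∑ τ ∈ s, (a τ : ℂ) * localizedExtension (χ.toFun τ) μ ρ ψ y) ∧
      (∀ ξ, g ξ ≠ 0 → ∃ τ ∈ s, ∃ η, ‖η‖ = ρ ∧ χ.toFun τ η ≠ 0 ∧ ψ (ξ - η) ≠ 0) ∧
      ∀ y, ‖𝓕⁻ (g : Plane → ℂ) y‖ₑ ≤ ENNReal.ofReal m * ∫⁻ ξ, ‖ψ ξ‖ₑ := by
  have hle : ∀ τ ∈ s, ∀ ξ, χ.toFun τ ξ ≤ 1 := fun τ hτ ξ =>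
    (Finset.single_le_sum (f := fun τ => χ.toFun τ ξ) (fun i hi => χ.nonneg i hi ξ)
      (hs hτ)).trans (χ.sum_le_one ξ)
  have hex : ∀ τ, ∃ g : 𝓢(Plane, ℂ), τ ∈ s →
      (∀ y, 𝓕⁻ (g : Plane → ℂ) y = localizedExtension (χ.toFun τ) μ ρ ψ y) ∧
      (∀ ξ, g ξ ≠ 0 → ∃ η, ‖η‖ = ρ ∧ χ.toFun τ η ≠ 0 ∧ ψ (ξ - η) ≠ 0) ∧
      ∫⁻ ξ, ‖g ξ‖ₑ ≤ (∫⁻ ξ, ‖ψ ξ‖ₑ) * ∫⁻ η, ‖χ.toFun τ η‖ₑ ∂circleMeasure ρ := by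
    intro τ
    by_cases hτ : τ ∈ s
    · obtain ⟨g, hg⟩ := exists_schwartz_localizedExtension (χ.smooth τ (hs hτ)).continuous
        (χ.nonneg τ (hs hτ)) (hle τ hτ) μ hρ hψ hψc
      exact ⟨g, fun _ => hg⟩
    · exact ⟨0, fun h => absurd h hτ⟩
  choose g hg using hex
  have hsum : ∀ ξ, (∑ τ ∈ s, ((a τ : ℝ) : ℂ) • g τ) ξ = ∑ τ ∈ s, (a τ : ℂ) * g τ ξ := by
    intro ξ; simp
  have hfun : ((∑ τ ∈ s, ((a τ : ℝ) : ℂ) • g τ : 𝓢(Plane, ℂ)) : Plane → ℂ) =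
      fun ξ => ∑ τ ∈ s, (a τ : ℂ) * g τ ξ := funext hsum
  have hinv : ∀ τ ∈ s, ∀ y, 𝓕⁻ (fun ξ => (a τ : ℂ) * g τ ξ) y =
      (a τ : ℂ) * localizedExtension (χ.toFun τ) μ ρ ψ y := by
    intro τ hτ y
    rw [← (hg τ hτ).1 y, Real.fourierInv_eq, Real.fourierInv_eq, ← integral_const_mul]
    congr 1; ext ξ
    simp only [Circle.smul_def, smul_eq_mul]; ring
  have hform : ∀ y, 𝓕⁻ ((∑ τ ∈ s, ((a τ : ℝ) : ℂ) • g τ : 𝓢(Plane, ℂ)) : Plane → ℂ) y =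
      ∑ τ ∈ s, (a τ : ℂ) * localizedExtension (χ.toFun τ) μ ρ ψ y := by
    intro y
    rw [hfun, fourierInv_finsetSum s _ (fun τ _ => (g τ).integrable.const_mul _)]
    exact Finset.sum_congr rfl fun τ hτ => hinv τ hτ y
  refine ⟨∑ τ ∈ s, ((a τ : ℝ) : ℂ) • g τ, hform, fun ξ hξ => ?_, fun y => ?_⟩
  · rw [hsum] at hξ
    obtain ⟨τ, hτ, h0⟩ := Finset.exists_ne_zero_of_sum_ne_zero hξ
    exact ⟨τ, hτ, (hg τ hτ).2.1 ξ (right_ne_zero_of_mul h0)⟩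
  · rw [hform]
    have hFle : ∀ τ ∈ s, ‖localizedExtension (χ.toFun τ) μ ρ ψ y‖ₑ ≤
        (∫⁻ ξ, ‖ψ ξ‖ₑ) * ∫⁻ η, ‖χ.toFun τ η‖ₑ ∂circleMeasure ρ := by
      intro τ hτ
      rw [← (hg τ hτ).1 y]
      refine le_trans ?_ (hg τ hτ).2.2
      rw [Real.fourierInv_eq]
      refine (enorm_integral_le_lintegral_enorm _).trans (le_of_eq ?_)
      refine lintegral_congr fun ξ => ?_
      rw [← ofReal_norm, Circle.norm_smul, ofReal_norm]
    calc ‖∑ τ ∈ s, (a τ : ℂ) * localizedExtension (χ.toFun τ) μ ρ ψ y‖ₑ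
        ≤ ∑ τ ∈ s, ‖(a τ : ℂ) * localizedExtension (χ.toFun τ) μ ρ ψ y‖ₑ := enorm_sum_le _ _
      _ ≤ ∑ τ ∈ s, ENNReal.ofReal m *
            ((∫⁻ ξ, ‖ψ ξ‖ₑ) * ∫⁻ η, ‖χ.toFun τ η‖ₑ ∂circleMeasure ρ) := by
          refine Finset.sum_le_sum fun τ hτ => ?_
          rw [enorm_mul]
          gcongr
          · rw [← ofReal_norm, Complex.norm_real]
            exact ENNReal.ofReal_le_ofReal (ha τ hτ)
          · exact hFle τ hτ
      _ = ENNReal.ofReal m * ((∫⁻ ξ, ‖ψ ξ‖ₑ) *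
            ∫⁻ η, ∑ τ ∈ s, ‖χ.toFun τ η‖ₑ ∂circleMeasure ρ) := by
          rw [lintegral_finsetSum' _ fun τ hτ =>
            (χ.smooth τ (hs hτ)).continuous.measurable.enorm.aemeasurable,
            Finset.mul_sum, Finset.mul_sum]
      _ ≤ ENNReal.ofReal m * ((∫⁻ ξ, ‖ψ ξ‖ₑ) * ∫⁻ η, 1 ∂circleMeasure ρ) := by
          gcongr with η
          calc ∑ τ ∈ s, ‖χ.toFun τ η‖ₑ = ∑ τ ∈ s, ENNReal.ofReal (χ.toFun τ η) :=
                Finset.sum_congr rfl fun τ hτ => by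
                  rw [← ofReal_norm, Real.norm_of_nonneg (χ.nonneg τ (hs hτ) η)]
            _ = ENNReal.ofReal (∑ τ ∈ s, χ.toFun τ η) :=
                (ENNReal.ofReal_sum_of_nonneg fun τ hτ => χ.nonneg τ (hs hτ) η).symm
            _ ≤ ENNReal.ofReal 1 := ENNReal.ofReal_le_ofReal
                ((Finset.sum_le_sum_of_subset_of_nonneg hs
                  fun τ hτ _ => χ.nonneg τ hτ η).trans (χ.sum_le_one η))
            _ = 1 := ENNReal.ofReal_one
      _ = _ := by simp

end FrequencyPieces

end BallInflation

namespace BallInflation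

/-! ### Arithmetic of the scales and inflation factors. -/

section Radius

variable {M : ℕ} {R : ℝ}

theorem delta_pos (M : ℕ) : 0 < delta M := by unfold delta; positivity

theorem two_pow_mul_delta (M : ℕ) : (2 : ℝ) ^ M * delta M = 1 := by
  unfold delta; exact mul_inv_cancel₀ (by positivity)

theorem radius_pos (hR : 1 ≤ R) (j : ℕ) : 0 < radius M R j :=
  Real.rpow_pos_of_pos (by linarith) _

theorem radius_mono (hR : 1 ≤ R) {i j : ℕ} (hij : i ≤ j) : radius M R i ≤ radius M R j := by
  refine Real.rpow_le_rpow_of_exponent_le hR (mul_le_mul_of_nonneg_right ?_ (delta_pos M).le)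
  exact pow_le_pow_right₀ (by norm_num) hij

/-- Squaring matches the scales to curvature: an arc of angle `1/r_j` on a circle of radius about
`R` has height about `R/r_j² = R/r_{j+1}`. -/
theorem radius_succ (hR : 1 ≤ R) (j : ℕ) : radius M R (j + 1) = radius M R j ^ 2 := by
  unfold radius
  rw [← Real.rpow_natCast (R ^ _), ← Real.rpow_mul (by linarith)]
  congr 1; push_cast; ring

theorem radius_self (M : ℕ) (R : ℝ) : radius M R M = R := by
  unfold radius; rw [two_pow_mul_delta, Real.rpow_one]

theorem radius_sq_le (hR : 1 ≤ R) {k : ℕ} (hk : k < M) : radius M R k ^ 2 ≤ R := by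
  rw [← radius_succ hR]
  exact (radius_mono hR hk).trans_eq (radius_self M R)

theorem radius_mul_sqrt_le (hR : 1 ≤ R) {k : ℕ} (hk : k < M) : radius M R k * √R ≤ R := by
  have h := Real.le_sqrt_of_sq_le (radius_sq_le hR hk)
  calc _ ≤ √R * √R := by gcongr
    _ = R := Real.mul_self_sqrt (by linarith)

theorem one_le_inflation (hR : 1 ≤ R) (k : ℕ) : 1 ≤ inflation M R k :=
  Real.one_le_rpow hR (by positivity)

/-- Of the two factors `R^{δ²}` gained per generation, one pays for the enlargement of tubes that
makes the tails negligible, the other absorbs numerical constants. -/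
theorem inflation_succ (hR : 1 ≤ R) (k : ℕ) :
    inflation M R (k + 1) = inflation M R k * (R ^ delta M ^ 2) ^ 2 := by
  unfold inflation
  rw [← Real.rpow_natCast (R ^ delta M ^ 2), ← Real.rpow_mul (by linarith),
    ← Real.rpow_add (by linarith)]
  congr 1; push_cast; ring

end Radius

/-! ### Angles and chords on the unit circle. -/

section UnitVectors

theorem inner_unitVec (x : Plane) (α : ℝ) :
    inner ℝ x (unitVec α) = x 0 * Real.cos α + x 1 * Real.sin α := by
  simp [unitVec, PiLp.inner_apply, Fin.sum_univ_two]; ring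

theorem inner_unitVec_perp (x : Plane) (α : ℝ) :
    inner ℝ x (unitVec (α + Real.pi / 2)) = x 1 * Real.cos α - x 0 * Real.sin α := by
  rw [inner_unitVec, Real.cos_add_pi_div_two, Real.sin_add_pi_div_two]; ring

theorem norm_sq_plane (x : Plane) : ‖x‖ ^ 2 = x 0 ^ 2 + x 1 ^ 2 := by
  rw [EuclideanSpace.norm_sq_eq]; simp [Fin.sum_univ_two]

theorem norm_sq_eq_inner_unitVec (x : Plane) (α : ℝ) :
    ‖x‖ ^ 2 = inner ℝ x (unitVec α) ^ 2 + inner ℝ x (unitVec (α + Real.pi / 2)) ^ 2 := by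
  rw [inner_unitVec, inner_unitVec_perp, norm_sq_plane]
  linear_combination (-(x 0 ^ 2 + x 1 ^ 2)) * Real.sin_sq_add_cos_sq α

theorem abs_inner_unitVec_le (x : Plane) (α : ℝ) : |inner ℝ x (unitVec α)| ≤ ‖x‖ := by
  simpa [norm_unitVec] using abs_real_inner_le_norm x (unitVec α)

theorem norm_unitVec_sub_sq (α β : ℝ) :
    ‖unitVec α - unitVec β‖ ^ 2 = 2 - 2 * Real.cos (α - β) := by
  rw [norm_sub_sq_real, norm_unitVec, norm_unitVec, inner_unitVec, Real.cos_sub]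
  simp [unitVec]; ring

theorem norm_unitVec_sub_le (α β : ℝ) : ‖unitVec α - unitVec β‖ ≤ |α - β| := by
  refine abs_le_of_sq_le_sq' ?_ (abs_nonneg _) |>.2
  rw [norm_unitVec_sub_sq, sq_abs]
  linarith [Real.one_sub_sq_div_two_le_cos (x := α - β)]

theorem unitVec_add_eq {α β : ℝ} (h : unitVec α = unitVec β) (γ : ℝ) :
    unitVec (α + γ) = unitVec (β + γ) := by
  have h0 : Real.cos α = Real.cos β := by simpa [unitVec] using congrArg (fun v : Plane => v 0) h
  have h1 : Real.sin α = Real.sin β := by simpa [unitVec] using congrArg (fun v : Plane => v 1) h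
  simp only [unitVec, Real.cos_add, Real.sin_add, h0, h1]

/-- Choosing the representative within `π` of `α₀`, the bound `cos x ≤ 1 - (2/π²) x²` on `[-π, π]`
turns a chord length into an angle. -/
theorem exists_angle_near (α α₀ : ℝ) :
    ∃ β, unitVec β = unitVec α ∧ |β - α₀| ≤ Real.pi / 2 * ‖unitVec α - unitVec α₀‖ := by
  have hper : Function.Periodic unitVec (2 * Real.pi) := fun x => by
    simp [unitVec]
  refine ⟨toIocMod Real.two_pi_pos (α₀ - Real.pi) α, ?_, ?_⟩
  · rw [toIocMod]
    exact hper.sub_zsmul_eq _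
  · set β := toIocMod Real.two_pi_pos (α₀ - Real.pi) α with hβ
    have hb : unitVec β = unitVec α := by
      rw [hβ, toIocMod]; exact hper.sub_zsmul_eq _
    have hmem := toIocMod_mem_Ioc Real.two_pi_pos (α₀ - Real.pi) α
    rw [← hβ] at hmem
    have habs : |β - α₀| ≤ Real.pi := by
      rw [abs_le]; constructor <;> linarith [hmem.1, hmem.2]
    have hcos := Real.cos_le_one_sub_mul_cos_sq habs
    rw [← hb]
    refine abs_le_of_sq_le_sq' ?_ (by positivity) |>.2
    rw [mul_pow, norm_unitVec_sub_sq, sq_abs]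
    have hpi := Real.pi_pos
    calc (β - α₀) ^ 2 = (Real.pi / 2) ^ 2 * (2 - 2 * (1 - 2 / Real.pi ^ 2 * (β - α₀) ^ 2)) := by
          field_simp; ring
      _ ≤ _ := by gcongr

end UnitVectors

/-! ### Caps: nesting, counting, and the location of the cutoffs on the circle. -/

section Arcs

theorem Arc.unitVec_mem {θ : Arc} {γ : ℝ} (hγ : |γ| < θ.length / 2) :
    unitVec (θ.mid + γ) ∈ θ.carrier := by
  rw [abs_lt] at hγ
  refine ⟨_, ⟨?_, ?_⟩, rfl⟩ <;> unfold Arc.mid <;> linarith [hγ.1, hγ.2]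

theorem Arc.unitVec_mid_mem (θ : Arc) : unitVec θ.mid ∈ θ.carrier := by
  have := θ.length_pos
  simpa using θ.unitVec_mem (γ := 0) (by simpa using this)

theorem Arc.exists_angle_of_mem {θ : Arc} {x : Plane} (hx : x ∈ θ.carrier) :
    ∃ β, |β - θ.mid| ≤ θ.length / 2 ∧ x = unitVec β := by
  obtain ⟨β, ⟨h1, h2⟩, rfl⟩ := hx
  refine ⟨β, ?_, rfl⟩
  unfold Arc.mid
  rw [abs_le]; constructor <;> linarith

theorem Arc.carrier_subset_circle (θ : Arc) : θ.carrier ⊆ Arc.circle.carrier := by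
  rintro _ ⟨β, -, rfl⟩
  have hper : Function.Periodic unitVec (2 * Real.pi) := fun x => by simp [unitVec]
  refine ⟨toIcoMod Real.two_pi_pos 0 β, ?_, ?_⟩
  · simpa [Arc.circle] using toIcoMod_mem_Ico Real.two_pi_pos 0 β
  · rw [toIcoMod]; exact hper.sub_zsmul_eq _

variable {M : ℕ} {R K : ℝ}

theorem CapSystem.one_le_K (𝒞 : CapSystem M R K) (hR : 1 ≤ R) (hM : 0 < M) : 1 ≤ K := by
  obtain ⟨θ, hθ, -⟩ := 𝒞.cover 0 hM (unitVec 0) (norm_unitVec 0)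
  have h1 := 𝒞.le_length 0 hM θ hθ
  have h2 := 𝒞.length_le 0 hM θ hθ
  have h3 := θ.length_pos
  have hr : 0 < (radius M R 0)⁻¹ := inv_pos.2 (radius_pos hR 0)
  have hK0 : 0 < K := pos_of_mul_pos_left (h3.trans_le h2) hr.le
  have h4 : K⁻¹ ≤ K := le_of_mul_le_mul_right (h1.trans h2) hr
  by_contra hK
  push Not at hK
  exact absurd (h4.trans_lt hK) (not_lt.2 ((one_lt_inv₀ hK0).2 hK).le)

theorem CapSystem.exists_ancestor (𝒞 : CapSystem M R K) {i j : ℕ} (hji : j ≤ i) (hi : i < M)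
    {τ : Arc} (hτ : τ ∈ 𝒞.caps i) : ∃ θ ∈ 𝒞.caps j, τ.carrier ⊆ θ.carrier := by
  induction i, hji using Nat.le_induction generalizing τ with
  | base => exact ⟨τ, hτ, Subset.rfl⟩
  | succ i _ ih =>
    obtain ⟨θ, hθ, h⟩ := 𝒞.nested i hi τ hτ
    obtain ⟨θ', hθ', h'⟩ := ih (by omega) hθ
    exact ⟨θ', hθ', h.trans h'⟩

theorem CapSystem.eq_of_subset (𝒞 : CapSystem M R K) {j : ℕ} (hj : j < M) {τ θ θ' : Arc}
    (hθ : θ ∈ 𝒞.caps j) (hθ' : θ' ∈ 𝒞.caps j) (h : τ.carrier ⊆ θ.carrier)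
    (h' : τ.carrier ⊆ θ'.carrier) : θ = θ' := by
  by_contra hne
  exact disjoint_left.1 (𝒞.disjoint j hj θ hθ θ' hθ' hne) (h τ.unitVec_mid_mem)
    (h' τ.unitVec_mid_mem)

theorem CapSystem.subset_or_disjoint (𝒞 : CapSystem M R K) {i j : ℕ} (hji : j ≤ i) (hi : i < M)
    {τ θ : Arc} (hτ : τ ∈ 𝒞.caps i) (hθ : θ ∈ 𝒞.caps j) :
    τ.carrier ⊆ θ.carrier ∨ Disjoint τ.carrier θ.carrier := by
  obtain ⟨θ', hθ', h⟩ := 𝒞.exists_ancestor hji hi hτ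
  by_cases he : θ' = θ
  · exact Or.inl (he ▸ h)
  · exact Or.inr ((𝒞.disjoint j (by omega) θ' hθ' θ hθ he).mono_left h)

theorem CapSystem.mem_capsIn {𝒞 : CapSystem M R K} {j : ℕ} {τ θ : Arc} :
    τ ∈ 𝒞.capsIn j θ ↔ τ ∈ 𝒞.caps j ∧ τ.carrier ⊆ θ.carrier := by
  simp [CapSystem.capsIn]

/-- The cap of generation `k` containing a smaller cap of a parent cap lies in that parent. -/
theorem CapSystem.exists_mem_capsIn (𝒞 : CapSystem M R K) {j k : ℕ} (hkj : k ≤ j) (hj : j < M)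
    {τ θ' : Arc} (hτ : τ ∈ 𝒞.caps j) (hθ' : θ' ∈ 𝒞.parentCaps k) (h : τ.carrier ⊆ θ'.carrier) :
    ∃ θ ∈ 𝒞.capsIn k θ', τ.carrier ⊆ θ.carrier := by
  obtain ⟨θ, hθ, hτθ⟩ := 𝒞.exists_ancestor hkj hj hτ
  refine ⟨θ, CapSystem.mem_capsIn.2 ⟨hθ, ?_⟩, hτθ⟩
  cases k with
  | zero =>
    rw [CapSystem.parentCaps, Finset.mem_singleton] at hθ'
    exact hθ' ▸ θ.carrier_subset_circle
  | succ k =>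
    rcases 𝒞.subset_or_disjoint (Nat.le_succ k) (by omega) hθ hθ' with h1 | h1
    · exact h1
    · exact absurd (h τ.unitVec_mid_mem) (disjoint_left.1 h1 (hτθ τ.unitVec_mid_mem))

open Classical in
/-- Sums over caps contained in a parent cap can be grouped by generation `k`. -/
theorem CapSystem.sum_filter_subset (𝒞 : CapSystem M R K) {j k : ℕ} (hkj : k ≤ j) (hj : j < M)
    {θ' : Arc} (hθ' : θ' ∈ 𝒞.parentCaps k) {S : Finset Arc} (hS : S ⊆ 𝒞.caps j) (f : Arc → ℂ) :
    ∑ τ ∈ S.filter (fun τ => τ.carrier ⊆ θ'.carrier), f τ =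
      ∑ θ ∈ 𝒞.capsIn k θ', ∑ τ ∈ S.filter (fun τ => τ.carrier ⊆ θ.carrier), f τ := by
  rw [← Finset.sum_biUnion]
  · refine Finset.sum_congr ?_ fun _ _ => rfl
    ext τ
    simp only [Finset.mem_filter, Finset.mem_biUnion]
    constructor
    · rintro ⟨h1, h2⟩
      obtain ⟨θ, hθ, h3⟩ := 𝒞.exists_mem_capsIn hkj hj (hS h1) hθ' h2
      exact ⟨θ, hθ, h1, h3⟩
    · rintro ⟨θ, hθ, h1, h3⟩
      exact ⟨h1, h3.trans (CapSystem.mem_capsIn.1 hθ).2⟩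
  · intro θ₁ h₁ θ₂ h₂ hne
    simp only [Function.onFun]
    rw [Finset.disjoint_left]
    intro τ hτ₁ hτ₂
    simp only [Finset.mem_filter] at hτ₁ hτ₂
    exact hne (𝒞.eq_of_subset (by omega) (CapSystem.mem_capsIn.1 (Finset.mem_coe.1 h₁)).1
      (CapSystem.mem_capsIn.1 (Finset.mem_coe.1 h₂)).1 hτ₁.2 hτ₂.2)

/-- The number of caps whose midpoints are near a given point of the circle. -/
theorem CapSystem.card_le_of_near (𝒞 : CapSystem M R K) (hR : 1 ≤ R) {k : ℕ} (hk : k < M)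
    {S : Finset Arc} (hS : S ⊆ 𝒞.caps k) (α₀ : ℝ) {D : ℝ} (hD0 : 0 ≤ D)
    (hD : ∀ θ ∈ S, ‖unitVec θ.mid - unitVec α₀‖ ≤ D) :
    (S.card : ℝ) ≤ 2 * Real.pi * D * K * radius M R k + 2 := by
  have hK := 𝒞.one_le_K hR (by omega)
  have hr := radius_pos (M := M) hR k
  have hpi := Real.pi_pos
  set a : ℝ := K * radius M R k with ha
  have ha0 : 0 < a := by positivity
  choose β hβ1 hβ2 using fun θ : Arc => exists_angle_near θ.mid α₀
  -- Caps have length at least `1/a`. Equal floors put the midpoints within less than `1/(2a)`,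
  -- hence one midpoint in the other cap, against disjointness.
  have hinj : Set.InjOn (fun θ => ⌊2 * a * (β θ - α₀)⌋) (S : Set Arc) := by
    intro θ hθ θ' hθ' he
    by_contra hne
    have hlt := Int.abs_sub_lt_one_of_floor_eq_floor he
    have hdisj := 𝒞.disjoint k hk θ (hS hθ) θ' (hS hθ') hne
    have hlen := 𝒞.le_length k hk θ (hS hθ)
    rw [← mul_inv, ← ha] at hlen
    refine Set.disjoint_left.1 hdisj (?_ : unitVec θ'.mid ∈ θ.carrier) θ'.unitVec_mid_mem
    have h1 := unitVec_add_eq (hβ1 θ) (β θ' - β θ)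
    rw [add_sub_cancel, hβ1 θ'] at h1
    rw [h1]
    refine Arc.unitVec_mem (lt_of_lt_of_le ?_ (div_le_div_of_nonneg_right hlen two_pos.le))
    rw [← mul_sub, abs_mul, abs_of_pos (by positivity), abs_sub_comm] at hlt
    rw [show β θ' - α₀ - (β θ - α₀) = β θ' - β θ by ring] at hlt
    rw [lt_div_iff₀ two_pos, ← one_mul a⁻¹, lt_mul_inv_iff₀ ha0]
    linarith
  have hmaps : ∀ θ ∈ S, ⌊2 * a * (β θ - α₀)⌋ ∈
      Finset.Icc ⌊-(Real.pi * D * a)⌋ ⌊Real.pi * D * a⌋ := by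
    intro θ hθ
    have h1 : |2 * a * (β θ - α₀)| ≤ Real.pi * D * a := by
      rw [abs_mul, abs_of_pos (by positivity)]
      calc 2 * a * |β θ - α₀| ≤ 2 * a * (Real.pi / 2 * D) := by
            gcongr; exact (hβ2 θ).trans (by gcongr; exact hD θ hθ)
        _ = _ := by ring
    rw [abs_le] at h1
    exact Finset.mem_Icc.2 ⟨Int.floor_le_floor h1.1, Int.floor_le_floor h1.2⟩
  have hcard := Finset.card_le_card_of_injOn _ hmaps hinj
  rw [Int.card_Icc] at hcard
  have hY : 0 ≤ Real.pi * D * a := by positivity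
  have hle : ⌊-(Real.pi * D * a)⌋ ≤ ⌊Real.pi * D * a⌋ := Int.floor_le_floor (by linarith)
  have h2 : ((S.card : ℤ)) ≤ ⌊Real.pi * D * a⌋ + 1 - ⌊-(Real.pi * D * a)⌋ := by omega
  have h3 : (S.card : ℝ) ≤ ⌊Real.pi * D * a⌋ + 1 - ⌊-(Real.pi * D * a)⌋ := by exact_mod_cast h2
  have h4 := Int.floor_le (Real.pi * D * a)
  have h5 := Int.sub_one_lt_floor (-(Real.pi * D * a))
  rw [ha] at *
  linarith

theorem CapSystem.card_caps_le (𝒞 : CapSystem M R K) (hR : 1 ≤ R) {k : ℕ} (hk : k < M) :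
    ((𝒞.caps k).card : ℝ) ≤ (4 * Real.pi * K + 2) * R := by
  have h := 𝒞.card_le_of_near hR hk Finset.Subset.rfl 0 zero_le_two fun θ _ =>
    (norm_sub_le _ _).trans (by rw [norm_unitVec, norm_unitVec]; norm_num)
  have h1 : radius M R k ≤ R := (radius_mono hR hk.le).trans_eq (radius_self M R)
  have hK := 𝒞.one_le_K hR (by omega)
  have hpi := Real.pi_pos
  calc _ ≤ _ := h
    _ ≤ 2 * Real.pi * 2 * K * R + 2 * R := by gcongr; linarith
    _ = _ := by ring

/-- A point of the circle of radius `ρ` in the support of a cutoff is near the direction of every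
cap containing the cap of that cutoff. -/
theorem Cutoffs.norm_sub_le {𝒞 : CapSystem M R K} (χ : Cutoffs 𝒞) (hR : 1 ≤ R) {k : ℕ}
    (hk : k < M) {Λ ρ : ℝ} (hΛ : 1 ≤ Λ) (hρ : R / Λ ≤ ρ) (hρ' : ρ ≤ Λ * R) {τ θ : Arc}
    (hτ : τ ∈ 𝒞.caps (M - 1)) (hθ : θ ∈ 𝒞.caps k) (h : τ.carrier ⊆ θ.carrier) {η : Plane}
    (hη : ‖η‖ = ρ) (hχ : χ.toFun τ η ≠ 0) :
    ‖η - ρ • unitVec θ.mid‖ ≤ (2 * K + Λ * K) * (R / radius M R k) := by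
  have hK := 𝒞.one_le_K hR (by omega)
  have hr := radius_pos (M := M) hR k
  have hρ0 : 0 < ρ := lt_of_lt_of_le (by positivity) hρ
  obtain ⟨ha, -, hp⟩ := χ.support_subset τ hτ η hχ
  set a := inner ℝ η (unitVec τ.mid)
  set p := inner ℝ η (unitVec (τ.mid + Real.pi / 2))
  have hsum : ρ ^ 2 = a ^ 2 + p ^ 2 := by rw [← hη]; exact norm_sq_eq_inner_unitVec η τ.mid
  -- Here `a ≥ 0` excludes the antipodal arc: the squared distance is `2ρ(ρ - a) ≤ 2(ρ + a)(ρ - a) =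
  -- 2p²`.
  have h1 : ‖η - ρ • unitVec τ.mid‖ ≤ 2 * |p| := by
    refine abs_le_of_sq_le_sq' ?_ (by positivity) |>.2
    have e : ‖η - ρ • unitVec τ.mid‖ ^ 2 = 2 * ρ * (ρ - a) := by
      rw [norm_sub_sq_real, hη, inner_smul_right, norm_smul, norm_unitVec, mul_one,
        Real.norm_of_nonneg hρ0.le]
      ring
    rw [e, mul_pow, sq_abs]
    have haρ : a ≤ ρ := abs_le_of_sq_le_sq' (by nlinarith [sq_nonneg p]) hρ0.le |>.2
    nlinarith [mul_nonneg ha (sub_nonneg.2 haρ)]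
  have h2 : √R ≤ R / radius M R k := by
    rw [le_div_iff₀ hr, mul_comm]; exact radius_mul_sqrt_le hR hk
  have h3 : ‖unitVec τ.mid - unitVec θ.mid‖ ≤ K * (radius M R k)⁻¹ := by
    obtain ⟨β, hβ, he⟩ := Arc.exists_angle_of_mem (h τ.unitVec_mid_mem)
    rw [he]
    have := 𝒞.length_le k hk θ hθ
    have := θ.length_pos
    linarith [norm_unitVec_sub_le β θ.mid]
  calc ‖η - ρ • unitVec θ.mid‖
      = ‖(η - ρ • unitVec τ.mid) + ρ • (unitVec τ.mid - unitVec θ.mid)‖ := by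
        rw [smul_sub]; congr 1; abel
    _ ≤ 2 * |p| + ρ * ‖unitVec τ.mid - unitVec θ.mid‖ := by
        refine (norm_add_le _ _).trans (add_le_add h1 (le_of_eq ?_))
        rw [norm_smul, Real.norm_of_nonneg hρ0.le]
    _ ≤ 2 * (K * (R / radius M R k)) + (Λ * R) * (K * (radius M R k)⁻¹) := by
        gcongr
        exact hp.trans (by gcongr)
    _ = _ := by rw [div_eq_mul_inv]; ring

end Arcs
end BallInflation

namespace BallInflation

/-! ### Dyadic squares and how bad caps pass from a square to its parent. -/

section Dyadic

theorem DyadicSquare.side_pos (Q : DyadicSquare) : 0 < Q.side := by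
  unfold DyadicSquare.side; positivity

theorem DyadicSquare.center_mem (Q : DyadicSquare) : Q.center ∈ Q.carrier := by
  intro i
  have := Q.side_pos
  simp only [DyadicSquare.center]
  constructor <;> nlinarith

/-- Intersecting dyadic squares are nested. -/
theorem DyadicSquare.subset_of_mem {P S : DyadicSquare} (hs : P.scale ≤ S.scale) {x : Plane}
    (hP : x ∈ P.carrier) (hS : x ∈ S.carrier) : P.carrier ⊆ S.carrier := by
  obtain ⟨n, hn⟩ := Int.le.dest hs
  have hside : S.side = 2 ^ n * P.side := by
    unfold DyadicSquare.side
    rw [← hn, zpow_add₀ two_ne_zero, zpow_natCast, mul_comm]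
  have hp := P.side_pos
  intro y hy i
  obtain ⟨h1, h2⟩ := hP i
  obtain ⟨h3, h4⟩ := hS i
  obtain ⟨h5, h6⟩ := hy i
  rw [hside, ← mul_assoc] at h3 h4
  have h7 : (S.idx i : ℝ) * 2 ^ n < P.idx i + 1 := lt_of_mul_lt_mul_right (h3.trans_lt h2) hp.le
  have h8 : (P.idx i : ℝ) < (S.idx i + 1) * 2 ^ n := lt_of_mul_lt_mul_right (h1.trans_lt h4) hp.le
  -- Integrality upgrades the strict inequalities given by a common point to containment.
  have h9 : S.idx i * 2 ^ n ≤ P.idx i := by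
    rw [← Int.lt_add_one_iff]; exact_mod_cast h7
  have h10 : P.idx i + 1 ≤ (S.idx i + 1) * 2 ^ n := by
    rw [Int.add_one_le_iff]; exact_mod_cast h8
  have h9' : (S.idx i : ℝ) * 2 ^ n ≤ P.idx i := by exact_mod_cast h9
  have h10' : (P.idx i : ℝ) + 1 ≤ (S.idx i + 1) * 2 ^ n := by exact_mod_cast h10
  rw [hside, ← mul_assoc, ← mul_assoc]
  exact ⟨(mul_le_mul_of_nonneg_right h9' hp.le).trans h5,
    h6.trans_le (mul_le_mul_of_nonneg_right h10' hp.le)⟩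

variable {M : ℕ} {R K : ℝ}

theorem scale_le_of_mem_squares (hR : 1 ≤ R) {i j : ℕ} (hij : i ≤ j) {P S : DyadicSquare}
    (hP : P ∈ squares M R i) (hS : S ∈ squares M R j) : P.scale ≤ S.scale := by
  rw [squares, mem_ofPred_eq] at hP hS
  rw [hP, hS]
  have := radius_pos (M := M) hR i
  exact Int.log_mono_right (by positivity)
    (div_le_div_of_nonneg_right (radius_mono hR hij) (by linarith))

theorem side_le_of_mem_squares (hR : 1 ≤ R) {j : ℕ} {Q : DyadicSquare} (hQ : Q ∈ squares M R j) :
    Q.side ≤ radius M R j / R := by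
  have := radius_pos (M := M) hR j
  rw [squares, mem_ofPred_eq] at hQ
  rw [DyadicSquare.side, hQ]
  exact_mod_cast Int.zpow_log_le_self (b := 2) one_lt_two
    (show (0 : ℝ) < radius M R j / R by positivity)

theorem le_side_of_mem_squares {j : ℕ} {Q : DyadicSquare} (hQ : Q ∈ squares M R j) :
    radius M R j / R ≤ 2 * Q.side := by
  rw [squares, mem_ofPred_eq] at hQ
  rw [DyadicSquare.side, hQ]
  have := Int.lt_zpow_succ_log_self (b := 2) one_lt_two (radius M R j / R)
  rw [Nat.cast_ofNat, zpow_add_one₀ two_ne_zero, mul_comm] at this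
  exact this.le

/-- From generation `k + 1` on, a square containing `Q` meets `Q'` and is at least as large, so it
contains `Q'` too. -/
theorem badCaps_eq_of_subset (𝒞 : CapSystem M R K) (hR : 1 ≤ R) (ν : Measure Plane) (t : ℝ)
    {k j : ℕ} (hkj : k + 1 ≤ j) {Q Q' : DyadicSquare} (hQ' : Q' ∈ squares M R (k + 1))
    (h : Q.carrier ⊆ Q'.carrier) : badCaps 𝒞 ν t j Q = badCaps 𝒞 ν t j Q' := by
  classical
  unfold badCaps
  split_ifs with hj
  · refine Finset.filter_congr fun θ _ => ?_
    constructor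
    · rintro ⟨P, hP, P', hP', h1, h2⟩
      exact ⟨P, hP, P', hP', DyadicSquare.subset_of_mem (scale_le_of_mem_squares hR hkj hQ' hP)
        (h Q.center_mem) (h1 Q.center_mem), h2⟩
    · rintro ⟨P, hP, P', hP', h1, h2⟩
      exact ⟨P, hP, P', hP', h.trans h1, h2⟩
  · rfl

theorem badCaps_subset (𝒞 : CapSystem M R K) (ν : Measure Plane) (t : ℝ) (j : ℕ)
    (Q : DyadicSquare) : badCaps 𝒞 ν t j Q ⊆ 𝒞.caps j := by
  classical
  unfold badCaps
  split_ifs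
  · exact Finset.filter_subset _ _
  · exact Finset.empty_subset _

theorem newBadCaps_subset (𝒞 : CapSystem M R K) (ν : Measure Plane) (t : ℝ) (k j : ℕ)
    (Q : DyadicSquare) : newBadCaps 𝒞 ν t k j Q ⊆ 𝒞.caps j := by
  classical
  exact fun _ hθ => badCaps_subset 𝒞 ν t j Q (Finset.mem_of_mem_filter _ hθ)

theorem badCaps_self (𝒞 : CapSystem M R K) (ν : Measure Plane) (t : ℝ) (Q : DyadicSquare) :
    badCaps 𝒞 ν t M Q = ∅ := by
  simp [badCaps]

open Classical in
/-- Inside a cap of generation `k` which is good for `Q`, the new bad caps are those that are new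
from generation `k + 1` on. -/
theorem newBadCaps_filter_subset (𝒞 : CapSystem M R K) (hR : 1 ≤ R) (ν : Measure Plane) (t : ℝ)
    {k j : ℕ} (hkj : k + 1 ≤ j) {Q Q' : DyadicSquare} (hQ' : Q' ∈ squares M R (k + 1))
    (h : Q.carrier ⊆ Q'.carrier) {θ : Arc} (hk : k < M) (hθ : θ ∈ 𝒞.caps k)
    (hgood : θ ∉ badCaps 𝒞 ν t k Q) :
    (newBadCaps 𝒞 ν t k j Q).filter (fun τ => τ.carrier ⊆ θ.carrier) =
      (newBadCaps 𝒞 ν t (k + 1) j Q').filter (fun τ => τ.carrier ⊆ θ.carrier) := by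
  ext τ
  simp only [newBadCaps, Finset.mem_filter, badCaps_eq_of_subset 𝒞 hR ν t hkj hQ' h]
  refine and_congr_left fun hτ => and_congr_right fun _ => ?_
  constructor
  · intro hd i hi θ' hθ'
    rw [Finset.mem_Ico] at hi
    refine hd i (Finset.mem_Ico.2 ⟨by omega, hi.2⟩) θ' ?_
    rwa [badCaps_eq_of_subset 𝒞 hR ν t hi.1 hQ' h]
  · intro hd i hi θ' hθ'
    rw [Finset.mem_Ico] at hi
    rcases hi.1.eq_or_lt with rfl | hlt
    -- Generation `k` is the one that `Q'` does not see. A bad cap there differs from the good cap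
    -- `θ`, so it is disjoint from `θ` and from `τ`.
    · have hne : θ ≠ θ' := fun he => hgood (he ▸ hθ')
      exact (𝒞.disjoint k hk θ hθ θ' (badCaps_subset 𝒞 ν t k Q hθ') hne).mono_left hτ
    · refine hd i (Finset.mem_Ico.2 ⟨hlt, hi.2⟩) θ' ?_
      rwa [← badCaps_eq_of_subset 𝒞 hR ν t hlt hQ' h]

-- A cap inside `θ` meets `θ`, whereas new bad caps are disjoint from the bad caps of generation
-- `k`.
open Classical in
theorem newBadCaps_filter_eq_empty (𝒞 : CapSystem M R K) (ν : Measure Plane) (t : ℝ)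
    {k j : ℕ} (hkj : k + 1 ≤ j) {Q : DyadicSquare} {θ : Arc} (hbad : θ ∈ badCaps 𝒞 ν t k Q) :
    (newBadCaps 𝒞 ν t k j Q).filter (fun τ => τ.carrier ⊆ θ.carrier) = ∅ := by
  refine Finset.filter_eq_empty_iff.2 fun τ hτ hsub => ?_
  have := (Finset.mem_filter.1 hτ).2 k (Finset.mem_Ico.2 ⟨le_rfl, hkj⟩) θ hbad
  exact Set.disjoint_left.1 this τ.unitVec_mid_mem (hsub τ.unitVec_mid_mem)

theorem newBadCaps_self (𝒞 : CapSystem M R K) (ν : Measure Plane) (t : ℝ) (k : ℕ)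
    (Q : DyadicSquare) : newBadCaps 𝒞 ν t k k Q = badCaps 𝒞 ν t k Q := by
  simp [newBadCaps]

end Dyadic

/-! ### Decomposition of `F_{Q,θ'}` into pieces of the next generation. -/

section GoodPieces

variable {M : ℕ} {R K : ℝ} {𝒞 : CapSystem M R K}

-- The bad caps of generation `k` are vacuously new, so both corrections merge into one sum. The
-- case `k = M`, with nothing to remove, is needed for the last generation of pieces.
open Classical in
theorem goodPiece_eq_sub_sum (χ : Cutoffs 𝒞) (μ ν : Measure Plane) (t ρ : ℝ) (ψ : Plane → ℝ)
    {k : ℕ} (hk : k ≤ M) (Q : DyadicSquare) (θ' : Arc) (y : Plane) :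
    goodPiece χ μ ν t ρ ψ k Q θ' y = capPiece χ μ ρ ψ θ' y -
      ∑ j ∈ Finset.Ico k M, ∑ θ ∈ (newBadCaps 𝒞 ν t k j Q).filter
        (fun θ => θ.carrier ⊆ θ'.carrier), capPiece χ μ ρ ψ θ y := by
  unfold goodPiece
  rcases hk.eq_or_lt with rfl | hlt
  · rw [badCaps_self, Finset.Ico_self, Finset.Ico_eq_empty (by omega)]; simp
  · rw [Finset.sum_eq_sum_Ico_succ_bot hlt, newBadCaps_self, sub_sub]

open Classical in
/-- `F_{Q,θ'}` is the sum of the `F_{Q',θ}` over the children `θ` of `θ'` which are good for `Q`. -/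
theorem goodPiece_eq_sum (χ : Cutoffs 𝒞) (hR : 1 ≤ R) (μ ν : Measure Plane) (t ρ : ℝ)
    (ψ : Plane → ℝ) {k : ℕ} (hk : k < M) {Q Q' : DyadicSquare} (hQ' : Q' ∈ squares M R (k + 1))
    (h : Q.carrier ⊆ Q'.carrier) {θ' : Arc} (hθ' : θ' ∈ 𝒞.parentCaps k) (y : Plane) :
    goodPiece χ μ ν t ρ ψ k Q θ' y =
      ∑ θ ∈ (𝒞.capsIn k θ').filter (fun θ => θ ∉ badCaps 𝒞 ν t k Q),
        goodPiece χ μ ν t ρ ψ (k + 1) Q' θ y := by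
  have hcap : capPiece χ μ ρ ψ θ' y = ∑ θ ∈ 𝒞.capsIn k θ', capPiece χ μ ρ ψ θ y :=
    𝒞.sum_filter_subset (by omega) (by omega) hθ' Finset.Subset.rfl _
  have hbad : ∑ θ ∈ (badCaps 𝒞 ν t k Q).filter (fun θ => θ.carrier ⊆ θ'.carrier),
      capPiece χ μ ρ ψ θ y =
      ∑ θ ∈ (𝒞.capsIn k θ').filter (fun θ => θ ∈ badCaps 𝒞 ν t k Q), capPiece χ μ ρ ψ θ y := by
    refine Finset.sum_congr ?_ fun _ _ => rfl
    ext θ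
    simp only [Finset.mem_filter, CapSystem.mem_capsIn]
    have := @badCaps_subset _ _ _ 𝒞 ν t k Q θ
    tauto
  -- Group the later removals by the generation-`k` cap containing them: under a bad cap there are
  -- none, and under a good cap they are those of `F_{Q',θ}`.
  have hnew : ∀ j ∈ Finset.Ico (k + 1) M,
      ∑ τ ∈ (newBadCaps 𝒞 ν t k j Q).filter (fun τ => τ.carrier ⊆ θ'.carrier),
        capPiece χ μ ρ ψ τ y =
      ∑ θ ∈ (𝒞.capsIn k θ').filter (fun θ => θ ∉ badCaps 𝒞 ν t k Q),
        ∑ τ ∈ (newBadCaps 𝒞 ν t (k + 1) j Q').filter (fun τ => τ.carrier ⊆ θ.carrier),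
          capPiece χ μ ρ ψ τ y := by
    intro j hj
    rw [Finset.mem_Ico] at hj
    rw [𝒞.sum_filter_subset (by omega : k ≤ j) hj.2 hθ' (newBadCaps_subset 𝒞 ν t k j Q),
      ← Finset.sum_filter_add_sum_filter_not _ (fun θ => θ ∈ badCaps 𝒞 ν t k Q)]
    rw [Finset.sum_eq_zero (s := Finset.filter (fun θ => θ ∈ badCaps 𝒞 ν t k Q) _), zero_add]
    · refine Finset.sum_congr rfl fun θ hθ => ?_
      rw [Finset.mem_filter, CapSystem.mem_capsIn] at hθ
      rw [newBadCaps_filter_subset 𝒞 hR ν t hj.1 hQ' h hk hθ.1.1 hθ.2]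
    · intro θ hθ
      rw [newBadCaps_filter_eq_empty 𝒞 ν t hj.1 (Finset.mem_filter.1 hθ).2, Finset.sum_empty]
  rw [goodPiece, hcap, hbad, Finset.sum_congr rfl hnew,
    ← Finset.sum_filter_add_sum_filter_not (𝒞.capsIn k θ') (fun θ => θ ∈ badCaps 𝒞 ν t k Q),
    add_sub_cancel_left, Finset.sum_comm, ← Finset.sum_sub_distrib]
  exact Finset.sum_congr rfl fun θ _ => (goodPiece_eq_sub_sum χ μ ν t ρ ψ hk Q' θ y).symm

open Classical in
theorem sum_capPiece_eq (χ : Cutoffs 𝒞) (μ : Measure Plane) (ρ : ℝ) (ψ : Plane → ℝ)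
    (θ' : Arc) (S : Finset Arc) (hS : ∀ θ ∈ S, θ.carrier ⊆ θ'.carrier) (y : Plane) :
    ∑ θ ∈ S, capPiece χ μ ρ ψ θ y = ∑ τ ∈ 𝒞.capsIn (M - 1) θ',
      ((S.filter fun θ => τ.carrier ⊆ θ.carrier).card : ℂ) *
        localizedExtension (χ.toFun τ) μ ρ ψ y := by
  have h1 : ∀ θ ∈ S, capPiece χ μ ρ ψ θ y = ∑ τ ∈ 𝒞.capsIn (M - 1) θ',
      if τ.carrier ⊆ θ.carrier then localizedExtension (χ.toFun τ) μ ρ ψ y else 0 := by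
    intro θ hθ
    rw [capPiece, ← Finset.sum_filter]
    refine Finset.sum_congr ?_ fun _ _ => rfl
    ext τ
    simp only [Finset.mem_filter, CapSystem.mem_capsIn]
    exact ⟨fun h => ⟨⟨h.1, h.2.trans (hS θ hθ)⟩, h.2⟩, fun h => ⟨h.1.1, h.2⟩⟩
  rw [Finset.sum_congr rfl h1, Finset.sum_comm]
  refine Finset.sum_congr rfl fun τ _ => ?_
  rw [← Finset.sum_filter, Finset.sum_const, nsmul_eq_mul]

open Classical in
/-- `F_{Q,θ'}` is a combination with bounded coefficients of the functions of the smallest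
caps. -/
theorem exists_goodPiece_coefficients (χ : Cutoffs 𝒞) (μ ν : Measure Plane) (t ρ : ℝ)
    (ψ : Plane → ℝ) {k : ℕ} (hk : k ≤ M) (Q : DyadicSquare) (θ' : Arc) :
    ∃ a : Arc → ℝ, (∀ τ, |a τ| ≤ M + 1) ∧ ∀ y, goodPiece χ μ ν t ρ ψ k Q θ' y =
      ∑ τ ∈ 𝒞.capsIn (M - 1) θ', (a τ : ℂ) * localizedExtension (χ.toFun τ) μ ρ ψ y := by
  let S : ℕ → Finset Arc := fun j =>
    (newBadCaps 𝒞 ν t k j Q).filter (fun θ => θ.carrier ⊆ θ'.carrier)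
  -- Caps of one generation are disjoint, so each generation removes `F_τ` at most once; hence the
  -- bound `M + 1` on the coefficients.
  have hS : ∀ j < M, ∀ τ : Arc, ((S j).filter fun θ => τ.carrier ⊆ θ.carrier).card ≤ 1 := by
    intro j hj τ
    refine Finset.card_le_one.2 fun θ₁ h₁ θ₂ h₂ => ?_
    simp only [S, Finset.mem_filter] at h₁ h₂
    exact 𝒞.eq_of_subset hj (newBadCaps_subset 𝒞 ν t k j Q h₁.1.1)
      (newBadCaps_subset 𝒞 ν t k j Q h₂.1.1) h₁.2 h₂.2
  refine ⟨fun τ => 1 - ∑ j ∈ Finset.Ico k M,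
    (((S j).filter fun θ => τ.carrier ⊆ θ.carrier).card : ℝ), fun τ => ?_, fun y => ?_⟩
  · have h0 : 0 ≤ ∑ j ∈ Finset.Ico k M,
        (((S j).filter fun θ => τ.carrier ⊆ θ.carrier).card : ℝ) :=
      Finset.sum_nonneg fun j _ => by positivity
    have h1 : ∑ j ∈ Finset.Ico k M,
        (((S j).filter fun θ => τ.carrier ⊆ θ.carrier).card : ℝ) ≤ M := by
      refine (Finset.sum_le_card_nsmul _ _ 1 fun j hj => ?_).trans ?_
      · exact_mod_cast hS j (Finset.mem_Ico.1 hj).2 τ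
      · simp
    rw [abs_le]; constructor <;> linarith
  · rw [goodPiece_eq_sub_sum χ μ ν t ρ ψ hk Q θ' y, capPiece]
    rw [Finset.sum_congr rfl fun j _ => sum_capPiece_eq χ μ ρ ψ θ' (S j)
      (fun θ hθ => (Finset.mem_filter.1 hθ).2) y, Finset.sum_comm, ← Finset.sum_sub_distrib]
    refine Finset.sum_congr rfl fun τ _ => ?_
    push_cast
    rw [sub_mul, one_mul, Finset.sum_mul]

end GoodPieces

end BallInflation

namespace BallInflation

/-! ### Dilated squares: volume, inclusion and bounded overlap. -/

section Dilates

theorem DyadicSquare.dilate_eq_preimage (Q : DyadicSquare) (lam : ℝ) :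
    Q.dilate lam = @WithLp.ofLp 2 (Fin 2 → ℝ) ⁻¹' (Set.univ.pi fun i =>
      Ico (Q.center i - lam * Q.side / 2) (Q.center i + lam * Q.side / 2)) := by
  ext x
  simp [DyadicSquare.dilate, Set.mem_pi]

theorem DyadicSquare.measurableSet_dilate (Q : DyadicSquare) (lam : ℝ) :
    MeasurableSet (Q.dilate lam) := by
  rw [DyadicSquare.dilate_eq_preimage]
  exact (PiLp.volume_preserving_ofLp (Fin 2)).measurable (MeasurableSet.univ_pi fun i => measurableSet_Ico)

theorem DyadicSquare.volume_dilate (Q : DyadicSquare) {lam : ℝ} (h : 0 ≤ lam) :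
    volume (Q.dilate lam) = ENNReal.ofReal ((lam * Q.side) ^ 2) := by
  have hs := Q.side_pos
  rw [DyadicSquare.dilate_eq_preimage,
    (PiLp.volume_preserving_ofLp (Fin 2)).measure_preimage
      (MeasurableSet.univ_pi fun i => measurableSet_Ico).nullMeasurableSet, Real.volume_pi_Ico]
  simp only [Fin.prod_univ_two]
  rw [← ENNReal.ofReal_mul (by nlinarith [mul_nonneg h hs.le])]
  congr 1; ring

theorem DyadicSquare.norm_sub_center_le {Q : DyadicSquare} {lam : ℝ} {x : Plane}
    (hx : x ∈ Q.dilate lam) : ‖x - Q.center‖ ≤ lam * Q.side := by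
  obtain ⟨h1, h2⟩ := hx 0
  obtain ⟨h3, h4⟩ := hx 1
  refine abs_le_of_sq_le_sq' ?_ (by linarith) |>.2
  rw [norm_sq_plane]
  simp only [PiLp.sub_apply]
  nlinarith

theorem DyadicSquare.abs_center_sub_le {Q Q' : DyadicSquare} (h : Q.carrier ⊆ Q'.carrier)
    (i : Fin 2) : |Q.center i - Q'.center i| ≤ (Q'.side - Q.side) / 2 := by
  have hs := Q.side_pos
  let z : ℝ → Plane := fun v => WithLp.toLp 2 fun j => if j = i then v else Q.idx j * Q.side
  have hz : ∀ v, Q.idx i * Q.side ≤ v → v < (Q.idx i + 1) * Q.side →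
      (Q'.idx i * Q'.side ≤ v ∧ v < (Q'.idx i + 1) * Q'.side) := by
    intro v h1 h2
    have : z v ∈ Q.carrier := by
      intro j
      by_cases hj : j = i
      · subst hj; simpa [z] using ⟨h1, h2⟩
      · simp only [z, hj, if_false]
        constructor <;> linarith
    simpa [z] using h this i
  have h1 := (hz (Q.idx i * Q.side) le_rfl (by linarith)).1
  have h2 : (Q.idx i + 1) * Q.side ≤ (Q'.idx i + 1) * Q'.side := by
    by_contra hcon
    push Not at hcon
    -- If `Q` protruded beyond the upper edge of `Q'`, a point of `Q` with this coordinate would lie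
    -- outside the half-open `Q'`.
    have h3 := (hz (max (Q.idx i * Q.side) ((Q'.idx i + 1) * Q'.side)) (le_max_left _ _)
      (max_lt (by linarith) hcon)).2
    exact absurd (le_max_right _ _) (not_le.2 h3)
  simp only [DyadicSquare.center]
  rw [abs_le]; constructor <;> linarith

theorem DyadicSquare.dilate_subset {Q Q' : DyadicSquare} (h : Q.carrier ⊆ Q'.carrier)
    {lam lam' : ℝ} (h1 : 1 ≤ lam) (h2 : lam ≤ lam') : Q.dilate lam ⊆ Q'.dilate lam' := by
  intro x hx i
  have hc := DyadicSquare.abs_center_sub_le h i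
  have hs := Q.side_pos
  have hs' : Q.side ≤ Q'.side := by linarith [abs_nonneg (Q.center i - Q'.center i)]
  obtain ⟨h3, h4⟩ := hx i
  rw [abs_le] at hc
  have h5 : (lam - 1) * Q.side ≤ (lam' - 1) * Q'.side :=
    mul_le_mul (by linarith) hs' hs.le (by linarith)
  constructor <;> linarith [hc.1, hc.2]

instance : Countable DyadicSquare := by
  refine Function.Injective.countable (f := fun Q : DyadicSquare => (Q.scale, Q.idx)) ?_
  rintro ⟨a, b⟩ ⟨c, d⟩ h
  simpa using h

/-- At most `4 lam ^ 2` of the dilates of the squares of one generation contain a given point. -/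
theorem exists_finset_dilate (n : ℤ) {lam : ℝ} (h1 : 1 ≤ lam) (x : Plane) :
    ∃ F : Finset DyadicSquare, (F.card : ℝ) ≤ 4 * lam ^ 2 ∧
      ∀ Q : DyadicSquare, Q.scale = n → x ∈ Q.dilate lam → Q ∈ F := by
  classical
  set s : ℝ := (2 : ℝ) ^ n with hs
  have hs0 : 0 < s := by positivity
  let I : Fin 2 → Finset ℤ := fun i =>
    Finset.Icc ⌈x i / s - 1 / 2 - lam / 2⌉ ⌊x i / s - 1 / 2 + lam / 2⌋
  have hI : ∀ i, ((I i).card : ℝ) ≤ 2 * lam := by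
    intro i
    simp only [I, Int.card_Icc]
    have h2 := Int.floor_le (x i / s - 1 / 2 + lam / 2)
    have h3 := Int.le_ceil (x i / s - 1 / 2 - lam / 2)
    rcases le_total (⌊x i / s - 1 / 2 + lam / 2⌋ + 1 - ⌈x i / s - 1 / 2 - lam / 2⌉) 0 with h | h
    · rw [Int.toNat_of_nonpos h]; simp; linarith
    · have h4 : (((⌊x i / s - 1 / 2 + lam / 2⌋ + 1 - ⌈x i / s - 1 / 2 - lam / 2⌉).toNat : ℤ) : ℝ)
          = ⌊x i / s - 1 / 2 + lam / 2⌋ + 1 - ⌈x i / s - 1 / 2 - lam / 2⌉ := by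
        rw [Int.toNat_of_nonneg h]; push_cast; ring
      rw [Int.cast_natCast] at h4
      rw [h4]
      linarith
  refine ⟨(Fintype.piFinset I).image fun idx => ⟨n, idx⟩, ?_, ?_⟩
  · refine (Nat.cast_le.2 Finset.card_image_le).trans ?_
    rw [Fintype.card_piFinset, Fin.prod_univ_two]
    push_cast
    calc ((I 0).card : ℝ) * (I 1).card ≤ (2 * lam) * (2 * lam) := by
          gcongr <;> apply hI
      _ = _ := by ring
  · rintro ⟨m, idx⟩ rfl hx
    refine Finset.mem_image.2 ⟨idx, Fintype.mem_piFinset.2 fun i => ?_, rfl⟩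
    obtain ⟨h2, h3⟩ := hx i
    simp only [DyadicSquare.center, DyadicSquare.side, ← hs] at h2 h3
    have h4 : (idx i : ℝ) + 1 / 2 - lam / 2 ≤ x i / s := by
      rw [le_div_iff₀ hs0]; linarith
    have h5 : x i / s < (idx i : ℝ) + 1 / 2 + lam / 2 := by
      rw [div_lt_iff₀ hs0]; linarith
    refine Finset.mem_Icc.2 ⟨Int.ceil_le.2 (by linarith), Int.le_floor.2 (by linarith)⟩

/-- The total measure of the dilates of squares of one generation, all contained in a set. -/
theorem tsum_measure_dilate_le (ν : Measure Plane) (n : ℤ) {lam : ℝ} (h1 : 1 ≤ lam)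
    (P : Set DyadicSquare) (hP : ∀ Q ∈ P, Q.scale = n) {E : Set Plane} (hE : MeasurableSet E)
    (hsub : ∀ Q ∈ P, Q.dilate lam ⊆ E) :
    ∑' Q : P, ν (Q.1.dilate lam) ≤ ENNReal.ofReal (4 * lam ^ 2) * ν E := by
  have e1 : ∀ Q : P, ν (Q.1.dilate lam) = ∫⁻ x, (Q.1.dilate lam).indicator 1 x ∂ν := fun Q =>
    (lintegral_indicator_one (Q.1.measurableSet_dilate lam)).symm
  simp_rw [e1]
  -- The total measure is the integral of the overlap function, which is at most `4 lam²` on `E` and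
  -- zero elsewhere.
  rw [← lintegral_tsum fun Q : P =>
    (measurable_one.indicator (Q.1.measurableSet_dilate lam)).aemeasurable]
  rw [← lintegral_indicator_const hE]
  refine lintegral_mono fun x => ?_
  by_cases hx : x ∈ E
  · rw [Set.indicator_of_mem hx]
    obtain ⟨F, hF, hmem⟩ := exists_finset_dilate n h1 x
    calc ∑' Q : P, (Q.1.dilate lam).indicator (1 : Plane → ℝ≥0∞) x
        ≤ ∑' Q : P, (F : Set DyadicSquare).indicator (1 : DyadicSquare → ℝ≥0∞) Q.1 := by
          refine ENNReal.tsum_le_tsum fun Q => ?_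
          by_cases hQ : x ∈ Q.1.dilate lam
          · rw [Set.indicator_of_mem hQ,
              Set.indicator_of_mem (Finset.mem_coe.2 (hmem Q.1 (hP Q.1 Q.2) hQ))]
            rfl
          · rw [Set.indicator_of_notMem hQ]; exact zero_le
      _ ≤ ∑' Q, (F : Set DyadicSquare).indicator (1 : DyadicSquare → ℝ≥0∞) Q :=
          ENNReal.tsum_comp_le_tsum_of_injective Subtype.val_injective _
      _ = (F.card : ℝ≥0∞) := by
          rw [← tsum_subtype]
          simp
      _ ≤ _ := by
          rw [← ENNReal.ofReal_natCast]
          exact ENNReal.ofReal_le_ofReal hF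
  · rw [Set.indicator_of_notMem hx, nonpos_iff_eq_zero, ENNReal.tsum_eq_zero]
    exact fun Q => Set.indicator_of_notMem (fun h => hx (hsub Q.1 Q.2 h)) _

end Dilates

end BallInflation

namespace BallInflation

open scoped SchwartzMap

/-! ### Averages over squares and tubes by linear changes of variables. -/

section LocalEstimates

/-- A linear map taking the coordinate frame to the orthogonal frame of direction `α`, scaled by
`l` along the direction and by `w` across it, together with its adjoint. -/
theorem exists_frame_map (α : ℝ) {w l : ℝ} (hw : 0 < w) (hl : 0 < l) :
    ∃ A B : Plane →L[ℝ] Plane, (∀ y ζ, inner ℝ (B y) ζ = inner ℝ y (A ζ)) ∧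
      (∀ y, inner ℝ (B y) (unitVec α) = l * y 0) ∧
      (∀ y, inner ℝ (B y) (unitVec (α + Real.pi / 2)) = w * y 1) ∧
      (∀ ζ, ‖A ζ‖ ≤ l * |inner ℝ ζ (unitVec α)| +
        w * |inner ℝ ζ (unitVec (α + Real.pi / 2))|) ∧
      ∀ f : Plane → ℝ≥0∞, Measurable f → ∀ x,
        ∫⁻ y, f (x - B y) = ENNReal.ofReal (w * l)⁻¹ * ∫⁻ z, f z := by
  let N : Matrix (Fin 2) (Fin 2) ℝ :=
    !![l * Real.cos α, -(w * Real.sin α); l * Real.sin α, w * Real.cos α]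
  let N' : Matrix (Fin 2) (Fin 2) ℝ :=
    !![l * Real.cos α, l * Real.sin α; -(w * Real.sin α), w * Real.cos α]
  let B : Plane →L[ℝ] Plane := LinearMap.toContinuousLinearMap (Matrix.toLpLin 2 2 N)
  let A : Plane →L[ℝ] Plane := LinearMap.toContinuousLinearMap (Matrix.toLpLin 2 2 N')
  have hB0 : ∀ y, B y 0 = l * Real.cos α * y 0 - w * Real.sin α * y 1 := fun y => by
    simp [B, N, Matrix.toLpLin_apply, dotProduct, Fin.sum_univ_two]; ring
  have hB1 : ∀ y, B y 1 = l * Real.sin α * y 0 + w * Real.cos α * y 1 := fun y => by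
    simp [B, N, Matrix.toLpLin_apply, dotProduct, Fin.sum_univ_two]
  have hA0 : ∀ y, A y 0 = l * inner ℝ y (unitVec α) := fun y => by
    rw [inner_unitVec]
    simp [A, N', Matrix.toLpLin_apply, dotProduct, Fin.sum_univ_two]; ring
  have hA1 : ∀ y, A y 1 = w * inner ℝ y (unitVec (α + Real.pi / 2)) := fun y => by
    rw [inner_unitVec_perp]
    simp [A, N', Matrix.toLpLin_apply, dotProduct, Fin.sum_univ_two]; ring
  have hsc := Real.sin_sq_add_cos_sq α
  refine ⟨A, B, fun y ζ => ?_, fun y => ?_, fun y => ?_, fun ζ => ?_, fun f hf x => ?_⟩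
  · have : ∀ u v : Plane, inner ℝ u v = u 0 * v 0 + u 1 * v 1 := fun u v => by
      simp [PiLp.inner_apply, Fin.sum_univ_two]; ring
    rw [this, this, hB0, hB1, hA0, hA1, inner_unitVec, inner_unitVec_perp]; ring
  · rw [inner_unitVec, hB0, hB1]; linear_combination (l * y 0) * hsc
  · rw [inner_unitVec_perp, hB0, hB1]; linear_combination (w * y 1) * hsc
  · refine abs_le_of_sq_le_sq' ?_ (by positivity) |>.2
    rw [norm_sq_plane, hA0, hA1]
    have h1 := mul_nonneg (mul_nonneg hl.le (abs_nonneg (inner ℝ ζ (unitVec α))))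
      (mul_nonneg hw.le (abs_nonneg (inner ℝ ζ (unitVec (α + Real.pi / 2)))))
    have h2 := sq_abs (inner ℝ ζ (unitVec α))
    have h3 := sq_abs (inner ℝ ζ (unitVec (α + Real.pi / 2)))
    rw [mul_pow, mul_pow, ← h2, ← h3]
    nlinarith
  · have hdet : LinearMap.det (Matrix.toLpLin 2 2 N : Plane →ₗ[ℝ] Plane) = w * l := by
      rw [Matrix.toLpLin_eq_toLin, LinearMap.det_toLin, Matrix.det_fin_two_of]
      linear_combination (w * l) * hsc
    have hmap := Measure.map_linearMap_addHaar_eq_smul_addHaar (volume : Measure Plane)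
      (f := Matrix.toLpLin 2 2 N) (by rw [hdet]; positivity)
    rw [hdet, abs_of_pos (by positivity)] at hmap
    have hBm : Measurable fun y => B y := B.continuous.measurable
    have hfm : Measurable fun z => f (x - z) := hf.comp (measurable_const.sub measurable_id)
    calc ∫⁻ y, f (x - B y) = ∫⁻ z, f (x - z) ∂(Measure.map (fun y => B y) volume) :=
          (lintegral_map hfm hBm).symm
      _ = ∫⁻ z, f (x - z) ∂(ENNReal.ofReal (w * l)⁻¹ • volume) := by rw [← hmap]; rfl
      _ = _ := by rw [lintegral_smul_measure, lintegral_sub_left_eq_self f x, smul_eq_mul]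

/-- The average over a dilated square is at most the weighted integral with a weight which is
at least one on the unit ball. -/
theorem DyadicSquare.average_le {Q : DyadicSquare} {lam : ℝ} (h : 0 < lam) {f : Plane → ℝ≥0∞}
    (hf : Measurable f) {η : Plane → ℂ} (hη : ∀ y, ‖y‖ ≤ 1 → 1 ≤ ‖η y‖) :
    (volume (Q.dilate lam))⁻¹ * ∫⁻ x in Q.dilate lam, f x ≤
      ∫⁻ y, f (Q.center + (lam * Q.side) • y) * ‖η y‖ₑ ^ 2 := by
  have hs := Q.side_pos
  set ℓ := lam * Q.side with hℓ
  have hℓ0 : 0 < ℓ := by positivity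
  have hm := Q.measurableSet_dilate lam
  have hmap := Measure.map_addHaar_smul (volume : Measure Plane) hℓ0.ne'
  rw [finrank_euclideanSpace_fin, abs_of_pos (by positivity)] at hmap
  rw [Q.volume_dilate h.le, ← hℓ, ← ENNReal.ofReal_inv_of_pos (by positivity),
    ← lintegral_indicator hm]
  have hfi : Measurable fun z => (Q.dilate lam).indicator f (Q.center + z) :=
    (hf.indicator hm).comp (measurable_const.add measurable_id)
  calc ENNReal.ofReal (ℓ ^ 2)⁻¹ * ∫⁻ x, (Q.dilate lam).indicator f x
      = ∫⁻ z, (Q.dilate lam).indicator f (Q.center + z) ∂(ENNReal.ofReal (ℓ ^ 2)⁻¹ • volume) := by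
        rw [lintegral_smul_measure, lintegral_add_left_eq_self
          (fun z => (Q.dilate lam).indicator f z) Q.center, smul_eq_mul]
    _ = ∫⁻ y, (Q.dilate lam).indicator f (Q.center + ℓ • y) := by
        rw [← hmap, lintegral_map hfi (measurable_const_smul ℓ)]
    _ ≤ _ := by
        refine lintegral_mono fun y => ?_
        by_cases hy : Q.center + ℓ • y ∈ Q.dilate lam
        · rw [Set.indicator_of_mem hy]
          have h1 := DyadicSquare.norm_sub_center_le hy
          rw [add_sub_cancel_left, norm_smul, Real.norm_of_nonneg hℓ0.le, ← hℓ] at h1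
          have h2 : ‖y‖ ≤ 1 := le_of_mul_le_mul_left (by linarith) hℓ0
          refine le_mul_of_one_le_right' (one_le_pow₀ ?_)
          rw [← ofReal_norm]
          exact ENNReal.one_le_ofReal.2 (hη y h2)
        · rw [Set.indicator_of_notMem hy]; exact zero_le

/-- The weighted integral of a function of restricted Fourier support over a small square is
controlled by its average over a tube, up to tails. -/
theorem lintegral_weighted_le {g η Φ : 𝓢(Plane, ℂ)} {s P : ℝ≥0∞}
    (hs : ∀ y, ‖𝓕⁻ (g : Plane → ℂ) y‖ₑ ≤ s) (hP : ∀ y, ‖Φ y‖ₑ ≤ P)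
    {A B : Plane →L[ℝ] Plane} (hAB : ∀ y ζ, inner ℝ (B y) ζ = inner ℝ y (A ζ)) {ξ₀ : Plane}
    (hΦ : ∀ ζ, g ζ ≠ 0 → 𝓕 Φ (A ζ - A ξ₀) = 1) {J : ℝ≥0∞}
    (hB : ∀ f : Plane → ℝ≥0∞, Measurable f → ∀ x, ∫⁻ y, f (x - B y) = J * ∫⁻ z, f z)
    {c : Plane} {ℓ X : ℝ} {T : Set Plane} (hT : MeasurableSet T)
    (hmem : ∀ y z, ‖y‖ ≤ X → ‖z‖ ≤ X → c + ℓ • y - B z ∈ T) :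
    ∫⁻ y, ‖𝓕⁻ (g : Plane → ℂ) (c + ℓ • y)‖ₑ ^ 2 * ‖η y‖ₑ ^ 2 ≤
      (∫⁻ y, ‖η y‖ₑ ^ 2) * (∫⁻ y, ‖Φ y‖ₑ) *
        (P * J * (∫⁻ z in T, ‖𝓕⁻ (g : Plane → ℂ) z‖ₑ ^ 2) +
          s ^ 2 * ∫⁻ y in {y | X < ‖y‖}, ‖Φ y‖ₑ) +
      s ^ 2 * ∫⁻ y in {y | X < ‖y‖}, ‖η y‖ₑ ^ 2 := by
  set G := 𝓕⁻ (g : Plane → ℂ) with hG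
  have hGm : Measurable fun z => ‖G z‖ₑ ^ 2 :=
    (continuous_fourierInv g.integrable).measurable.enorm.pow_const 2
  have hset : MeasurableSet {y : Plane | X < ‖y‖} := measurableSet_lt measurable_const measurable_norm
  have hcompl : {y : Plane | X < ‖y‖}ᶜ = {y | ‖y‖ ≤ X} := by ext y; simp
  have hset' : MeasurableSet {y : Plane | ‖y‖ ≤ X} := hcompl ▸ hset.compl
  -- Local constancy at one point: for `‖z‖ ≤ X` the displaced point stays in `T` and `|Φ|` is
  -- replaced by its supremum; for larger `z` the uniform bound `s` and the decay of `Φ` suffice.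
  have hpt : ∀ y, ‖y‖ ≤ X → ‖G (c + ℓ • y)‖ₑ ^ 2 ≤ (∫⁻ y, ‖Φ y‖ₑ) *
      (P * J * (∫⁻ z in T, ‖G z‖ₑ ^ 2) + s ^ 2 * ∫⁻ y in {y | X < ‖y‖}, ‖Φ y‖ₑ) := by
    intro y hy
    refine (enorm_fourierInv_sq_le g.integrable Φ hAB ξ₀ hΦ (c + ℓ • y)).trans ?_
    gcongr
    rw [← lintegral_add_compl _ hset, hcompl, add_comm]
    gcongr
    · calc ∫⁻ z in {z | ‖z‖ ≤ X}, ‖Φ z‖ₑ * ‖G (c + ℓ • y - B z)‖ₑ ^ 2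
          ≤ ∫⁻ z in {z | ‖z‖ ≤ X}, P * T.indicator (fun z => ‖G z‖ₑ ^ 2) (c + ℓ • y - B z) := by
            refine setLIntegral_mono_ae' hset' (Filter.Eventually.of_forall fun z hz => ?_)
            rw [Set.indicator_of_mem (hmem y z hy hz)]
            gcongr
            exact hP z
        _ ≤ ∫⁻ z, P * T.indicator (fun z => ‖G z‖ₑ ^ 2) (c + ℓ • y - B z) :=
            setLIntegral_le_lintegral _ _
        _ = P * J * ∫⁻ z in T, ‖G z‖ₑ ^ 2 := by
            have hcm : Measurable fun z => T.indicator (fun z => ‖G z‖ₑ ^ 2) (c + ℓ • y - B z) :=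
              (hGm.indicator hT).comp (measurable_const.sub B.continuous.measurable)
            rw [lintegral_const_mul _ hcm, hB _ (hGm.indicator hT),
              lintegral_indicator hT, mul_assoc]
    · rw [← lintegral_const_mul _ Φ.continuous.measurable.enorm]
      refine lintegral_mono fun z => ?_
      rw [mul_comm]
      gcongr
      exact hs _
  rw [← lintegral_add_compl _ hset, hcompl, add_comm]
  refine add_le_add ?_ ?_
  · calc ∫⁻ y in {y | ‖y‖ ≤ X}, ‖G (c + ℓ • y)‖ₑ ^ 2 * ‖η y‖ₑ ^ 2
        ≤ ∫⁻ y in {y | ‖y‖ ≤ X}, ((∫⁻ y, ‖Φ y‖ₑ) * (P * J * (∫⁻ z in T, ‖G z‖ₑ ^ 2) +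
            s ^ 2 * ∫⁻ y in {y | X < ‖y‖}, ‖Φ y‖ₑ)) * ‖η y‖ₑ ^ 2 := by
          refine setLIntegral_mono_ae' hset' (Filter.Eventually.of_forall fun y hy => ?_)
          gcongr
          exact hpt y hy
      _ ≤ ∫⁻ y, ((∫⁻ y, ‖Φ y‖ₑ) * (P * J * (∫⁻ z in T, ‖G z‖ₑ ^ 2) +
            s ^ 2 * ∫⁻ y in {y | X < ‖y‖}, ‖Φ y‖ₑ)) * ‖η y‖ₑ ^ 2 :=
          setLIntegral_le_lintegral _ _
      _ = _ := by
          rw [lintegral_const_mul _ (η.continuous.measurable.enorm.pow_const 2)]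
          ring
  · rw [← lintegral_const_mul _ (η.continuous.measurable.enorm.pow_const 2)]
    refine lintegral_mono fun y => ?_
    gcongr
    exact hs _

end LocalEstimates

end BallInflation

namespace BallInflation

open scoped SchwartzMap

/-! ### Frequency localization of the pieces and the local estimate on one square. -/

section LocalEstimates

variable {M : ℕ} {R K : ℝ}

theorem measurableSet_tube (c : Plane) (α w l : ℝ) : MeasurableSet (tube c α w l) := by
  have h : ∀ β : ℝ, Continuous fun x : Plane => |inner ℝ (x - c) (unitVec β)| := fun β => by
    fun_prop
  exact ((isClosed_le (h α) continuous_const).inter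
    (isClosed_le (h _) continuous_const)).measurableSet

/-- The frequency region of the function attached to a cap `θ` of generation `k`. -/
theorem Cutoffs.frequency_mem {𝒞 : CapSystem M R K} (χ : Cutoffs 𝒞) (hR : 1 ≤ R) {k : ℕ}
    (hk : k < M) {Λ ρ : ℝ} (hΛ : 1 ≤ Λ) (hρ : R / Λ ≤ ρ) (hρ' : ρ ≤ Λ * R) {τ θ : Arc}
    (hτ : τ ∈ 𝒞.caps (M - 1)) (hθ : θ ∈ 𝒞.caps k) (h : τ.carrier ⊆ θ.carrier) {η ξ : Plane}
    (hη : ‖η‖ = ρ) (hχ : χ.toFun τ η ≠ 0) {r : ℝ} (hξ : ‖ξ - η‖ ≤ r) :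
    ‖ξ - ρ • unitVec θ.mid‖ ≤ (2 * K + Λ * K + r) * (R / radius M R k) ∧
      radius M R (k + 1) / R * |inner ℝ (ξ - ρ • unitVec θ.mid) (unitVec θ.mid)| ≤
        (2 * K + Λ * K) ^ 2 * Λ + r := by
  have h1 := χ.norm_sub_le hR hk hΛ hρ hρ' hτ hθ h hη hχ
  set C₁ := 2 * K + Λ * K
  set e := unitVec θ.mid
  have hr := radius_pos (M := M) hR k
  have hr0 : 0 ≤ r := (norm_nonneg _).trans hξ
  have hrk := radius_sq_le hR hk
  have hρ0 : 0 < ρ := lt_of_lt_of_le (by positivity) hρ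
  have hW : 1 ≤ R / radius M R k := by
    rw [one_le_div hr]
    exact (radius_mono hR hk.le).trans_eq (radius_self M R)
  have hsplit : ξ - ρ • e = (ξ - η) + (η - ρ • e) := by abel
  constructor
  · calc ‖ξ - ρ • e‖ ≤ ‖ξ - η‖ + ‖η - ρ • e‖ := hsplit ▸ norm_add_le _ _
      _ ≤ r * (R / radius M R k) + C₁ * (R / radius M R k) := by
          gcongr; nlinarith
      _ = _ := by ring
  -- Curvature: both points lie on the circle of radius `ρ`, so the component along `e` is quadratic
  -- in their distance, of order `(R/r_k)²/R = R/r_{k+1}`.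
  · have h2 : ‖η - ρ • e‖ ^ 2 = -(2 * ρ) * inner ℝ (η - ρ • e) e := by
      rw [norm_sub_sq_real, inner_sub_left, inner_smul_left, real_inner_self_eq_norm_sq,
        norm_unitVec, hη, inner_smul_right, norm_smul, norm_unitVec, mul_one,
        Real.norm_of_nonneg hρ0.le]
      simp; ring
    have h3 : |inner ℝ (η - ρ • e) e| * (2 * ρ) = ‖η - ρ • e‖ ^ 2 := by
      rw [abs_of_nonpos (by nlinarith [sq_nonneg ‖η - ρ • e‖]), h2]; ring
    have h4 : radius M R (k + 1) / R * |inner ℝ (η - ρ • e) e| ≤ C₁ ^ 2 * Λ := by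
      rw [radius_succ hR]
      have h5 : |inner ℝ (η - ρ • e) e| * (R / Λ) ≤ (C₁ * (R / radius M R k)) ^ 2 := by
        calc |inner ℝ (η - ρ • e) e| * (R / Λ) ≤ |inner ℝ (η - ρ • e) e| * (2 * ρ) := by
              gcongr; linarith
          _ = ‖η - ρ • e‖ ^ 2 := h3
          _ ≤ _ := by gcongr
      calc radius M R k ^ 2 / R * |inner ℝ (η - ρ • e) e|
          = radius M R k ^ 2 / R * (Λ / R) * (|inner ℝ (η - ρ • e) e| * (R / Λ)) := by
            field_simp
        _ ≤ radius M R k ^ 2 / R * (Λ / R) * (C₁ * (R / radius M R k)) ^ 2 := by gcongr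
        _ = C₁ ^ 2 * Λ := by field_simp
    have h6 : radius M R (k + 1) / R ≤ 1 := by
      rw [radius_succ hR, div_le_one (by linarith)]; exact hrk
    have h7 : |inner ℝ (ξ - η) e| ≤ r := (abs_inner_unitVec_le _ _).trans hξ
    have h8 : 0 < radius M R (k + 1) / R := div_pos (radius_pos hR _) (by linarith)
    calc radius M R (k + 1) / R * |inner ℝ (ξ - ρ • e) e|
        ≤ radius M R (k + 1) / R * (|inner ℝ (ξ - η) e| + |inner ℝ (η - ρ • e) e|) := by
          rw [hsplit, inner_add_left]; gcongr; exact abs_add_le _ _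
      _ = radius M R (k + 1) / R * |inner ℝ (ξ - η) e| +
            radius M R (k + 1) / R * |inner ℝ (η - ρ • e) e| := by ring
      _ ≤ 1 * r + C₁ ^ 2 * Λ := by gcongr
      _ = _ := by ring

set_option maxHeartbeats 1600000 in
open Classical in
/-- Local orthogonality and local constancy: the mass of `F_{Q,θ'}` on the square `Q` is
controlled by averages of the functions of the good caps over tubes centred at `Q`. -/
theorem exists_local_estimate (M : ℕ) (K Λ : ℝ) (hΛ : 1 ≤ Λ) {ψ : Plane → ℝ}
    (hψ : ContDiff ℝ ∞ ψ) (hψc : HasCompactSupport ψ) :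
    ∃ C : ℝ, 0 ≤ C ∧ ∃ D : ℕ → ℝ, (∀ m, 0 ≤ D m) ∧
      ∀ (R ρ : ℝ), 1 ≤ R → R / Λ ≤ ρ → ρ ≤ Λ * R →
      ∀ (𝒞 : CapSystem M R K) (χ : Cutoffs 𝒞) (μ ν : Measure Plane) [IsProbabilityMeasure μ]
        (t : ℝ), ∀ k < M, ∀ Q' ∈ squares M R (k + 1), ∀ θ' ∈ 𝒞.parentCaps k,
        ∀ Q ∈ squares M R k, Q.carrier ⊆ Q'.carrier → ∀ (m : ℕ) (X : ℝ), 1 ≤ X →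
        weightedMass ν (goodPiece χ μ ν t ρ ψ k Q θ') (Q.dilate (inflation M R k)) ≤
          ν (Q.dilate (inflation M R k)) *
            ∑ θ ∈ (𝒞.capsIn k θ').filter (fun θ => θ ∉ badCaps 𝒞 ν t k Q),
              (ENNReal.ofReal (C * (radius M R k / R * (radius M R (k + 1) / R))⁻¹) *
                (∫⁻ y in tube Q.center θ.mid
                    (4 * (inflation M R k * X) * (radius M R k / R))
                    (4 * (inflation M R k * X) * (radius M R (k + 1) / R)),
                  ‖goodPiece χ μ ν t ρ ψ (k + 1) Q' θ y‖ₑ ^ 2) +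
                ENNReal.ofReal (D m * (X ^ m)⁻¹)) := by
  obtain ⟨η, hηF, hη1⟩ := exists_schwartz_band_limited (V := Plane)
  obtain ⟨r₀, hr₀⟩ := hψc.isCompact.isBounded.subset_closedBall 0
  set r : ℝ := max r₀ 0 with hr
  have hrψ : ∀ ξ, ψ ξ ≠ 0 → ‖ξ‖ ≤ r := fun ξ hξ =>
    (mem_closedBall_zero_iff.1 (hr₀ (subset_tsupport _ hξ))).trans (le_max_left _ _)
  have hr0 : 0 ≤ r := le_max_right _ _
  -- The radius is the sum of the bounds for the frequency components along and across `θ`, after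
  -- scaling by `r_{k+1}/R` and `r_k/R` respectively.
  obtain ⟨Φ, hΦ⟩ := exists_fourier_eq_one_on_ball (V := Plane)
    ((2 * K + Λ * K) ^ 2 * Λ + r + (2 * K + Λ * K + r))
  obtain ⟨P, hP0, hP⟩ := Φ.decay 0 0
  simp only [pow_zero, one_mul, norm_iteratedFDeriv_zero] at hP
  choose Cη hCη0 hCη using exists_lintegral_sq_tail_le η
  choose CΦ hCΦ0 hCΦ using exists_lintegral_tail_le Φ
  have hH : ∫⁻ y, ‖η y‖ₑ ^ 2 ≠ ⊤ := by
    have := (η.memLp 2 (μ := volume)).integrable_norm_pow two_ne_zero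
    convert this.2.ne using 3 with y
    simp
  have hI : ∫⁻ y, ‖Φ y‖ₑ ≠ ⊤ := lintegral_enorm_ne_top Φ
  have hΨ : ∫⁻ ξ, ‖ψ ξ‖ₑ ≠ ⊤ :=
    (hψ.continuous.integrable_of_hasCompactSupport (μ := volume) hψc).2.ne
  set H := (∫⁻ y, ‖η y‖ₑ ^ 2).toReal with hHdef
  set I := (∫⁻ y, ‖Φ y‖ₑ).toReal with hIdef
  set Ψ := (∫⁻ ξ, ‖ψ ξ‖ₑ).toReal with hΨdef
  -- The overlap number: the count of `card_le_of_near` for caps with midpoints within `2Λ(2K + ΛK +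
  -- r + 2)/r_k`, where `r_k` cancels.
  set n : ℕ := ⌈2 * Real.pi * (2 * Λ * (2 * K + Λ * K + r + 2)) * K + 2⌉₊ with hn
  set s : ℝ := (M + 1) * Ψ with hs
  have hs0 : 0 ≤ s := by positivity
  refine ⟨n * (H * I * P), by positivity, fun m => n * (H * I * s ^ 2 * CΦ m + s ^ 2 * Cη m),
    fun m => ?_, ?_⟩
  · have := hCη0 m; have := hCΦ0 m; positivity
  intro R ρ hR hρ hρ' 𝒞 χ μ ν _ t k hk Q' hQ' θ' hθ' Q hQ hQQ' m X hX
  have hK := 𝒞.one_le_K hR (by omega)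
  have hrk := radius_pos (M := M) hR k
  have hrk1 := radius_pos (M := M) hR (k + 1)
  have hR0 : 0 < R := by linarith
  have hρ0 : 0 < ρ := lt_of_lt_of_le (by positivity) hρ
  set lam := inflation M R k with hlam
  have hlam1 : 1 ≤ lam := one_le_inflation hR k
  set w := radius M R k / R with hw
  set l := radius M R (k + 1) / R with hl
  have hw0 : 0 < w := by positivity
  have hl0 : 0 < l := by positivity
  have hwl : w ≤ l := by
    rw [hw, hl]; exact div_le_div_of_nonneg_right (radius_mono hR (Nat.le_succ k)) hR0.le
  have hside := side_le_of_mem_squares hR hQ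
  have hside2 := le_side_of_mem_squares hQ
  have hs1 := Q.side_pos
  rw [← hw] at hside hside2
  have hw1 : w * (R / radius M R k) = 1 := by rw [hw]; field_simp
  have hW0 : 0 < R / radius M R k := by positivity
  -- the Schwartz functions representing the pieces
  have hex : ∀ θ, ∃ g : 𝓢(Plane, ℂ), θ ∈ 𝒞.capsIn k θ' →
      (∀ y, 𝓕⁻ (g : Plane → ℂ) y = goodPiece χ μ ν t ρ ψ (k + 1) Q' θ y) ∧
      (∀ ξ, g ξ ≠ 0 → ‖ξ - ρ • unitVec θ.mid‖ ≤ (2 * K + Λ * K + r) * (R / radius M R k) ∧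
        l * |inner ℝ (ξ - ρ • unitVec θ.mid) (unitVec θ.mid)| ≤
          (2 * K + Λ * K) ^ 2 * Λ + r) ∧
      ∀ y, ‖𝓕⁻ (g : Plane → ℂ) y‖ₑ ≤ ENNReal.ofReal s := by
    intro θ
    by_cases hθ : θ ∈ 𝒞.capsIn k θ'
    · obtain ⟨a, ha, haeq⟩ := exists_goodPiece_coefficients χ μ ν t ρ ψ (k := k + 1) hk Q' θ
      obtain ⟨g, hg1, hg2, hg3⟩ := exists_schwartz_combination χ μ hρ0.le hψ hψc
        (s := 𝒞.capsIn (M - 1) θ) (fun τ hτ => (CapSystem.mem_capsIn.1 hτ).1) (a := a)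
        (m := M + 1) (fun τ _ => ha τ)
      refine ⟨g, fun _ => ⟨fun y => (hg1 y).trans (haeq y).symm, fun ξ hξ => ?_, fun y => ?_⟩⟩
      · obtain ⟨τ, hτ, _, h1, h2, h3⟩ := hg2 ξ hξ
        rw [CapSystem.mem_capsIn] at hτ hθ
        exact χ.frequency_mem hR hk hΛ hρ hρ' hτ.1 hθ.1 hτ.2 h1 h2 (hrψ _ h3)
      · refine (hg3 y).trans (le_of_eq ?_)
        rw [hs, ENNReal.ofReal_mul (by positivity), hΨdef, ENNReal.ofReal_toReal hΨ]
    · exact ⟨0, fun h => absurd h hθ⟩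
  choose g hg using hex
  set S := (𝒞.capsIn k θ').filter (fun θ => θ ∉ badCaps 𝒞 ν t k Q) with hS
  have hSsub : ∀ θ ∈ S, θ ∈ 𝒞.capsIn k θ' := fun θ hθ => (Finset.mem_filter.1 hθ).1
  have hpiece : ∀ y, goodPiece χ μ ν t ρ ψ k Q θ' y = ∑ θ ∈ S, 𝓕⁻ (g θ : Plane → ℂ) y := by
    intro y
    rw [goodPiece_eq_sum χ hR μ ν t ρ ψ hk hQ' hQQ' hθ' y]
    exact Finset.sum_congr rfl fun θ hθ => ((hg θ (hSsub θ hθ)).1 y).symm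
  -- Frequencies counted at the same `ξ` differ by `O(R/r_k)`, since `lam * Q.side ≥ w/2`. The
  -- points `ρ e_θ` are then equally close, and dividing by `ρ` bounds the directions.
  have hcount : ∀ ξ, ∀ s' ⊆ S, (∀ θ ∈ s', ∃ ζ, g θ ζ ≠ 0 ∧ ‖ξ - (lam * Q.side) • ζ‖ ≤ 1) →
      s'.card ≤ n := by
    intro ξ s' hs' hξ
    rcases s'.eq_empty_or_nonempty with rfl | ⟨θ₀, hθ₀⟩
    · simp
    obtain ⟨ζ₀, hζ₀, hζ₀'⟩ := hξ θ₀ hθ₀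
    have hb0 := ((hg θ₀ (hSsub _ (hs' hθ₀))).2.1 ζ₀ hζ₀).1
    set ℓ := lam * Q.side with hℓ
    have hℓ0 : 0 < ℓ := by positivity
    have hℓw : w ≤ 2 * ℓ := by
      have := le_mul_of_one_le_left hs1.le hlam1
      linarith
    have hnear : ∀ θ ∈ s', ‖unitVec θ.mid - unitVec θ₀.mid‖ ≤
        2 * Λ * (2 * K + Λ * K + r + 2) / radius M R k := by
      intro θ hθ
      obtain ⟨ζ, hζ, hζ'⟩ := hξ θ hθ
      have hb := ((hg θ (hSsub _ (hs' hθ))).2.1 ζ hζ).1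
      have h1 : ℓ * ‖ζ₀ - ζ‖ ≤ 2 := by
        calc ℓ * ‖ζ₀ - ζ‖ = ‖(ξ - ℓ • ζ) - (ξ - ℓ • ζ₀)‖ := by
              rw [sub_sub_sub_cancel_left, ← smul_sub, norm_smul, Real.norm_of_nonneg hℓ0.le]
          _ ≤ 2 := (norm_sub_le _ _).trans (by linarith)
      have h2 : ‖ζ₀ - ζ‖ ≤ 4 * (R / radius M R k) := by
        have h3 : w * ‖ζ₀ - ζ‖ ≤ 4 := by
          have := mul_le_mul_of_nonneg_right hℓw (norm_nonneg (ζ₀ - ζ))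
          linarith
        calc ‖ζ₀ - ζ‖ = (w * ‖ζ₀ - ζ‖) * (R / radius M R k) := by
              rw [mul_right_comm, hw1, one_mul]
          _ ≤ _ := by gcongr
      have h4 : ρ * ‖unitVec θ.mid - unitVec θ₀.mid‖ ≤
          2 * (2 * K + Λ * K + r + 2) * (R / radius M R k) := by
        calc ρ * ‖unitVec θ.mid - unitVec θ₀.mid‖
            = ‖(ζ₀ - ρ • unitVec θ₀.mid) - (ζ - ρ • unitVec θ.mid) - (ζ₀ - ζ)‖ := by
              rw [show (ζ₀ - ρ • unitVec θ₀.mid) - (ζ - ρ • unitVec θ.mid) - (ζ₀ - ζ) =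
                ρ • (unitVec θ.mid - unitVec θ₀.mid) by rw [smul_sub]; abel, norm_smul,
                Real.norm_of_nonneg hρ0.le]
          _ ≤ ‖ζ₀ - ρ • unitVec θ₀.mid‖ + ‖ζ - ρ • unitVec θ.mid‖ + ‖ζ₀ - ζ‖ :=
              (norm_sub_le _ _).trans (by gcongr; exact norm_sub_le _ _)
          _ ≤ _ := by linarith
      have h5 : R / Λ * ‖unitVec θ.mid - unitVec θ₀.mid‖ ≤
          2 * (2 * K + Λ * K + r + 2) * (R / radius M R k) :=
        le_trans (by gcongr) h4
      calc ‖unitVec θ.mid - unitVec θ₀.mid‖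
          = Λ / R * (R / Λ * ‖unitVec θ.mid - unitVec θ₀.mid‖) := by field_simp
        _ ≤ Λ / R * (2 * (2 * K + Λ * K + r + 2) * (R / radius M R k)) := by gcongr
        _ = _ := by field_simp
    have hcard := 𝒞.card_le_of_near hR hk (S := s')
      (fun θ hθ => (CapSystem.mem_capsIn.1 (hSsub _ (hs' hθ))).1) θ₀.mid (by positivity) hnear
    have hle : (s'.card : ℝ) ≤ 2 * Real.pi * (2 * Λ * (2 * K + Λ * K + r + 2)) * K + 2 := by
      refine hcard.trans (le_of_eq ?_)
      field_simp
    exact_mod_cast hle.trans (Nat.le_ceil _)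
  have horth := lintegral_sum_fourierInv_mul_sq_le S g η hηF Q.center (lam * Q.side) n hcount
  have hθest : ∀ θ ∈ S,
      ∫⁻ y, ‖𝓕⁻ (g θ : Plane → ℂ) (Q.center + (lam * Q.side) • y)‖ₑ ^ 2 * ‖η y‖ₑ ^ 2 ≤
      ENNReal.ofReal (H * I * P * (w * l)⁻¹) * (∫⁻ y in tube Q.center θ.mid
          (4 * (lam * X) * w) (4 * (lam * X) * l),
          ‖goodPiece χ μ ν t ρ ψ (k + 1) Q' θ y‖ₑ ^ 2) +
        ENNReal.ofReal ((H * I * s ^ 2 * CΦ m + s ^ 2 * Cη m) * (X ^ m)⁻¹) := by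
    intro θ hθ
    obtain ⟨hg1, hg2, hg3⟩ := hg θ (hSsub θ hθ)
    obtain ⟨A, B, hAB, hBe, hBp, hA, hBint⟩ := exists_frame_map θ.mid hw0 hl0
    have hXm : 0 ≤ (X ^ m)⁻¹ := by positivity
    have hHI : 0 ≤ H * I := by positivity
    have key := lintegral_weighted_le (η := η) (P := ENNReal.ofReal P) hg3
      (fun y => by rw [← ofReal_norm]; exact ENNReal.ofReal_le_ofReal (hP y)) hAB
      (ξ₀ := ρ • unitVec θ.mid) (fun ζ hζ => ?_) hBint (c := Q.center) (ℓ := lam * Q.side) (X := X)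
      (measurableSet_tube Q.center θ.mid (4 * (lam * X) * w) (4 * (lam * X) * l)) ?_
    · refine key.trans ?_
      simp_rw [hg1]
      rw [← ENNReal.ofReal_toReal hH, ← ENNReal.ofReal_toReal hI, ← hHdef, ← hIdef]
      have e1 : ENNReal.ofReal (H * I * P * (w * l)⁻¹) = ENNReal.ofReal H * ENNReal.ofReal I *
          (ENNReal.ofReal P * ENNReal.ofReal (w * l)⁻¹) := by
        rw [mul_assoc (H * I), ENNReal.ofReal_mul hHI, ENNReal.ofReal_mul ENNReal.toReal_nonneg,
          ENNReal.ofReal_mul hP0.le]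
      have e2 : ENNReal.ofReal ((H * I * s ^ 2 * CΦ m + s ^ 2 * Cη m) * (X ^ m)⁻¹) =
          ENNReal.ofReal H * ENNReal.ofReal I * (ENNReal.ofReal s ^ 2 *
            ENNReal.ofReal (CΦ m * (X ^ m)⁻¹)) +
            ENNReal.ofReal s ^ 2 * ENNReal.ofReal (Cη m * (X ^ m)⁻¹) := by
        have := hCΦ0 m
        have := hCη0 m
        rw [← ENNReal.ofReal_pow hs0, ← ENNReal.ofReal_mul (by positivity),
          ← ENNReal.ofReal_mul (by positivity), ← ENNReal.ofReal_mul (by positivity),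
          ← ENNReal.ofReal_mul (by positivity), ← ENNReal.ofReal_add (by positivity)
          (by positivity)]
        congr 1; ring
      rw [e1, e2, mul_add, add_assoc, mul_assoc (ENNReal.ofReal H * ENNReal.ofReal I)]
      gcongr
      · exact hCΦ m X (by linarith)
      · exact hCη m X (by linarith)
    · obtain ⟨h1, h2⟩ := hg2 ζ hζ
      rw [← map_sub]
      refine hΦ _ ((hA _).trans (add_le_add h2 ?_))
      calc w * |inner ℝ (ζ - ρ • unitVec θ.mid) (unitVec (θ.mid + Real.pi / 2))|
          ≤ w * ((2 * K + Λ * K + r) * (R / radius M R k)) := by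
            gcongr; exact (abs_inner_unitVec_le _ _).trans h1
        _ = (2 * K + Λ * K + r) * (w * (R / radius M R k)) := by ring
        _ = _ := by rw [hw1, mul_one]
    -- The moves inside the square and along `B z` are each at most `lam X l` along the tube and
    -- `lam X w` across it; together they fill the half-widths of the factor `4`.
    · intro y z hy hz
      have hy' : ‖(lam * Q.side) • y‖ ≤ lam * X * w := by
        rw [norm_smul, Real.norm_of_nonneg (by positivity)]
        calc lam * Q.side * ‖y‖ ≤ lam * w * X := by gcongr
          _ = _ := by ring
      have hz0 : |z 0| ≤ X := (PiLp.norm_apply_le z 0).trans hz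
      have hz1 : |z 1| ≤ X := (PiLp.norm_apply_le z 1).trans hz
      have hlX : X ≤ lam * X := le_mul_of_one_le_left (by linarith) hlam1
      have hsub : ∀ β, inner ℝ (Q.center + (lam * Q.side) • y - B z - Q.center) (unitVec β) =
          inner ℝ ((lam * Q.side) • y) (unitVec β) - inner ℝ (B z) (unitVec β) := fun β => by
        rw [← inner_sub_left]; congr 1; abel
      have habs : ∀ β, |inner ℝ ((lam * Q.side) • y) (unitVec β)| ≤ lam * X * w := fun β =>
        (abs_inner_unitVec_le _ _).trans hy'
      constructor
      · rw [hsub, hBe]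
        refine (abs_sub _ _).trans ?_
        rw [abs_mul, abs_of_pos hl0]
        have h1 := habs θ.mid
        have h2 : l * |z 0| ≤ l * (lam * X) := by gcongr; exact hz0.trans hlX
        have h3 : lam * X * w ≤ lam * X * l := by gcongr
        linarith
      · rw [hsub, hBp]
        refine (abs_sub _ _).trans ?_
        rw [abs_mul, abs_of_pos hw0]
        have h1 := habs (θ.mid + Real.pi / 2)
        have h2 : w * |z 1| ≤ w * (lam * X) := by gcongr; exact hz1.trans hlX
        linarith
  have hFm : Measurable fun y => ‖goodPiece χ μ ν t ρ ψ k Q θ' y‖ₑ ^ 2 := by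
    have : Continuous fun y => ∑ θ ∈ S, 𝓕⁻ (g θ : Plane → ℂ) y :=
      continuous_finsetSum _ fun θ _ => continuous_fourierInv (g θ).integrable
    simp_rw [hpiece]
    exact this.measurable.enorm.pow_const 2
  rw [weightedMass, ProbabilityTheory.cond, lintegral_smul_measure, smul_eq_mul]
  refine mul_le_mul_right ?_ _
  refine (DyadicSquare.average_le (by linarith) hFm hη1).trans ?_
  simp_rw [hpiece]
  refine horth.trans ?_
  rw [Finset.mul_sum]
  refine Finset.sum_le_sum fun θ hθ => (mul_le_mul_right (hθest θ hθ) _).trans (le_of_eq ?_)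
  rw [mul_add, ← mul_assoc, ← ENNReal.ofReal_natCast, ← ENNReal.ofReal_mul (by positivity),
    ← ENNReal.ofReal_mul (by positivity)]
  congr 1
  · congr 2; ring
  · congr 1; ring

end LocalEstimates

end BallInflation

namespace BallInflation

/-! ### Sizes of the inflation factors and the bound with polynomial loss. -/

section BallInflationEstimates

variable {M : ℕ} {R K : ℝ}

theorem inflation_le_self (hR : 1 ≤ R) (hM : 0 < M) {j : ℕ} (hj : j ≤ M) :
    inflation M R j ≤ R := by
  unfold inflation
  refine (Real.rpow_le_rpow_of_exponent_le hR ?_).trans_eq (Real.rpow_one R)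
  have h1 : ((j : ℝ) + 1) * delta M ≤ 1 := by
    have h2 : ((j + 1 : ℕ) : ℝ) ≤ (2 : ℝ) ^ M := by
      exact_mod_cast (Nat.succ_le_succ hj).trans (Nat.lt_two_pow_self (n := M))
    push_cast at h2
    exact (mul_le_mul_of_nonneg_right h2 (delta_pos M).le).trans_eq (two_pow_mul_delta M)
  have h3 : 2 * delta M ≤ 1 := by
    rw [← two_pow_mul_delta M]
    refine mul_le_mul_of_nonneg_right ?_ (delta_pos M).le
    calc (2 : ℝ) = 2 ^ 1 := by norm_num
      _ ≤ 2 ^ M := pow_le_pow_right₀ (by norm_num) hM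
  have h4 := delta_pos M
  have h5 : 0 ≤ ((j : ℝ) + 1) * delta M := by positivity
  calc 2 * ((j : ℝ) + 1) * delta M ^ 2 = (((j : ℝ) + 1) * delta M) * (2 * delta M) := by ring
    _ ≤ 1 * 1 := mul_le_mul h1 h3 (by positivity) zero_le_one
    _ = 1 := one_mul 1

/-- It comes down to `2(M + 1) ≤ 2^M`, hence `M ≥ 3`. It makes the enlarged tubes fit in the
`R^δ`-dilates that define badness. -/
theorem inflation_le_rpow_delta (hR : 1 ≤ R) (hM : 3 ≤ M) {j : ℕ} (hj : j ≤ M) :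
    inflation M R j ≤ R ^ delta M := by
  unfold inflation
  refine Real.rpow_le_rpow_of_exponent_le hR ?_
  have h0 : 2 * (M + 1) ≤ 2 ^ M := by
    clear hj
    induction M, hM using Nat.le_induction with
    | base => norm_num
    | succ n hn ih => rw [pow_succ]; omega
  have h1 : 2 * ((j : ℝ) + 1) * delta M ≤ 1 := by
    have h2 : ((2 * (j + 1) : ℕ) : ℝ) ≤ (2 : ℝ) ^ M := by
      exact_mod_cast (Nat.mul_le_mul_left 2 (Nat.succ_le_succ hj)).trans h0
    push_cast at h2
    exact (mul_le_mul_of_nonneg_right h2 (delta_pos M).le).trans_eq (two_pow_mul_delta M)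
  calc 2 * ((j : ℝ) + 1) * delta M ^ 2 = (2 * ((j : ℝ) + 1) * delta M) * delta M := by ring
    _ ≤ 1 * delta M := mul_le_mul_of_nonneg_right h1 (delta_pos M).le
    _ = _ := one_mul _

theorem continuous_goodPiece {𝒞 : CapSystem M R K} (χ : Cutoffs 𝒞) (μ ν : Measure Plane)
    [IsProbabilityMeasure μ] (t : ℝ) {ρ : ℝ} (hρ : 0 ≤ ρ) {ψ : Plane → ℝ} (hψ : ContDiff ℝ ∞ ψ)
    (hψc : HasCompactSupport ψ) {k : ℕ} (hk : k ≤ M) (Q : DyadicSquare) (θ : Arc) :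
    Continuous (goodPiece χ μ ν t ρ ψ k Q θ) := by
  obtain ⟨a, ha, haeq⟩ := exists_goodPiece_coefficients χ μ ν t ρ ψ hk Q θ
  obtain ⟨g, hg, -⟩ := exists_schwartz_combination χ μ hρ hψ hψc
    (s := 𝒞.capsIn (M - 1) θ) (fun τ hτ => (CapSystem.mem_capsIn.1 hτ).1) (a := a)
    (m := M + 1) (fun τ _ => ha τ)
  rw [show goodPiece χ μ ν t ρ ψ k Q θ = _ from funext fun y => (haeq y).trans (hg y).symm]
  exact continuous_fourierInv g.integrable

theorem weightedMass_eq (ν : Measure Plane) (F : Plane → ℂ) (S : Set Plane) :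
    weightedMass ν F S = ν S * ((volume S)⁻¹ * ∫⁻ y in S, ‖F y‖ₑ ^ 2) := by
  rw [weightedMass, ProbabilityTheory.cond, lintegral_smul_measure, smul_eq_mul]

theorem le_weightedMass (hR : 1 ≤ R) (ν : Measure Plane) (F : Plane → ℂ) {j : ℕ}
    {Q : DyadicSquare} (hQ : Q ∈ squares M R j) {lam : ℝ} (hlam : 0 < lam) :
    ENNReal.ofReal ((lam * (radius M R j / R)) ^ 2)⁻¹ *
        (ν (Q.dilate lam) * ∫⁻ y in Q.dilate lam, ‖F y‖ₑ ^ 2) ≤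
      weightedMass ν F (Q.dilate lam) := by
  have hs := Q.side_pos
  have hside := side_le_of_mem_squares hR hQ
  rw [weightedMass_eq, Q.volume_dilate hlam.le, ← ENNReal.ofReal_inv_of_pos (by positivity),
    mul_left_comm]
  gcongr

theorem tsum_measure_children_le (hR : 1 ≤ R) (ν : Measure Plane) {k : ℕ} {Q' : DyadicSquare}
    {E : Set Plane} (hE : MeasurableSet E)
    (hsub : ∀ Q : DyadicSquare, Q.carrier ⊆ Q'.carrier → Q.dilate (inflation M R k) ⊆ E) :
    ∑' Q : {Q : DyadicSquare // Q ∈ squares M R k ∧ Q.carrier ⊆ Q'.carrier},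
      ν (Q.1.dilate (inflation M R k)) ≤
      ENNReal.ofReal (4 * inflation M R k ^ 2) * ν E :=
  tsum_measure_dilate_le ν (Int.log 2 (radius M R k / R)) (one_le_inflation hR k)
    {Q | Q ∈ squares M R k ∧ Q.carrier ⊆ Q'.carrier} (fun _ hQ => hQ.1) hE
    fun Q hQ => hsub Q hQ.2

theorem inflation_mono (hR : 1 ≤ R) (k : ℕ) : inflation M R k ≤ inflation M R (k + 1) := by
  rw [inflation_succ hR]
  exact le_mul_of_one_le_right (by linarith [one_le_inflation (M := M) hR k])
    (one_le_pow₀ (Real.one_le_rpow hR (by positivity)))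

/-- The estimate with a loss of a fixed power of `R`. -/
theorem tsum_weightedMass_le_pow (hR : 1 ≤ R) {𝒞 : CapSystem M R K} (χ : Cutoffs 𝒞)
    (μ ν : Measure Plane) [IsProbabilityMeasure μ] (t : ℝ) {ρ : ℝ} (hρ : 0 ≤ ρ)
    {ψ : Plane → ℝ} (hψ : ContDiff ℝ ∞ ψ) (hψc : HasCompactSupport ψ) {k : ℕ} (hk : k < M)
    {Q' : DyadicSquare} (hQ' : Q' ∈ squares M R (k + 1)) {θ' : Arc}
    (hθ' : θ' ∈ 𝒞.parentCaps k) :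
    ∑' Q : {Q : DyadicSquare // Q ∈ squares M R k ∧ Q.carrier ⊆ Q'.carrier},
        weightedMass ν (goodPiece χ μ ν t ρ ψ k Q.1 θ') (Q.1.dilate (inflation M R k)) ≤
      ENNReal.ofReal (16 * (4 * Real.pi * K + 2) * R ^ 7) * ∑ θ ∈ 𝒞.capsIn k θ',
        weightedMass ν (goodPiece χ μ ν t ρ ψ (k + 1) Q' θ) (Q'.dilate (inflation M R (k + 1))) := by
  classical
  have hK := 𝒞.one_le_K hR (by omega)
  have hpi := Real.pi_pos
  have hR0 : 0 < R := by linarith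
  have hrk := radius_pos (M := M) hR k
  have hrk1 := radius_pos (M := M) hR (k + 1)
  set lam := inflation M R k with hlam
  set lam' := inflation M R (k + 1) with hlam'
  have h1 : 1 ≤ lam := one_le_inflation hR k
  have h1' : 1 ≤ lam' := one_le_inflation hR (k + 1)
  have hle : lam ≤ lam' := inflation_mono hR k
  have hlR : lam ≤ R := inflation_le_self hR (by omega) hk.le
  have hlR' : lam' ≤ R := inflation_le_self hR (by omega) hk
  set w := radius M R k / R with hw
  set l := radius M R (k + 1) / R with hl
  have hw0 : 0 < w := by positivity
  have hl0 : 0 < l := by positivity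
  have hlw : l = radius M R k * w := by rw [hl, hw, radius_succ hR]; ring
  have hrR : radius M R k ≤ R := (radius_mono hR hk.le).trans_eq (radius_self M R)
  set S' := Q'.dilate lam' with hS'
  set n := (𝒞.capsIn k θ').card with hn
  have hnR : (n : ℝ) ≤ (4 * Real.pi * K + 2) * R := by
    refine le_trans ?_ (𝒞.card_caps_le hR hk)
    exact_mod_cast Finset.card_le_card fun θ hθ => (CapSystem.mem_capsIn.1 hθ).1
  set G : Arc → Plane → ℂ := fun θ => goodPiece χ μ ν t ρ ψ (k + 1) Q' θ with hG
  have hGm : ∀ θ, Measurable fun y => ‖G θ y‖ₑ ^ 2 := fun θ =>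
    (continuous_goodPiece χ μ ν t hρ hψ hψc hk Q' θ).measurable.enorm.pow_const 2
  set Y := ∑ θ ∈ 𝒞.capsIn k θ', ∫⁻ y in S', ‖G θ y‖ₑ ^ 2 with hY
  -- No orthogonality here: enlarge the domain to the dilate of `Q'` and apply Cauchy–Schwarz over
  -- all `n` caps.
  have hQ : ∀ Q : {Q : DyadicSquare // Q ∈ squares M R k ∧ Q.carrier ⊆ Q'.carrier},
      weightedMass ν (goodPiece χ μ ν t ρ ψ k Q.1 θ') (Q.1.dilate lam) ≤
      ν (Q.1.dilate lam) * (ENNReal.ofReal (4 / w ^ 2) * (n * Y)) := by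
    rintro ⟨Q, hQ, hQQ'⟩
    have hs := Q.side_pos
    have hside2 := le_side_of_mem_squares hQ
    rw [← hw] at hside2
    rw [weightedMass_eq, Q.volume_dilate (by linarith)]
    refine mul_le_mul_right (mul_le_mul' ?_ ?_) _
    · rw [← ENNReal.ofReal_inv_of_pos (by positivity)]
      apply ENNReal.ofReal_le_ofReal
      rw [inv_le_comm₀ (by positivity) (by positivity), inv_div]
      have h2 : w / 2 ≤ lam * Q.side := by
        have := le_mul_of_one_le_left hs.le h1
        linarith
      calc w ^ 2 / 4 = (w / 2) ^ 2 := by ring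
        _ ≤ _ := by gcongr
    · calc ∫⁻ y in Q.dilate lam, ‖goodPiece χ μ ν t ρ ψ k Q θ' y‖ₑ ^ 2
          ≤ ∫⁻ y in S', ‖goodPiece χ μ ν t ρ ψ k Q θ' y‖ₑ ^ 2 :=
            lintegral_mono_set (DyadicSquare.dilate_subset hQQ' h1 hle)
        _ ≤ ∫⁻ y in S', n * ∑ θ ∈ 𝒞.capsIn k θ', ‖G θ y‖ₑ ^ 2 := by
            refine lintegral_mono fun y => ?_
            rw [goodPiece_eq_sum χ hR μ ν t ρ ψ hk hQ' hQQ' hθ' y]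
            refine (enorm_sum_sq_le _ _ n ((Finset.card_filter_le _ _).trans
              (Finset.card_filter_le _ _))).trans ?_
            gcongr
            exact Finset.filter_subset _ _
        _ = n * Y := by
            rw [lintegral_const_mul _ (Finset.measurable_fun_sum _ fun θ _ => hGm θ),
              lintegral_finsetSum _ fun θ _ => hGm θ]
  refine (ENNReal.tsum_le_tsum hQ).trans ?_
  rw [ENNReal.tsum_mul_right]
  refine (mul_le_mul_left (tsum_measure_children_le hR ν (Q'.measurableSet_dilate lam')
    fun Q hQQ' => DyadicSquare.dilate_subset hQQ' h1 hle) _).trans ?_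
  have hlow : ENNReal.ofReal ((lam' * l) ^ 2)⁻¹ * (ν S' * Y) ≤
      ∑ θ ∈ 𝒞.capsIn k θ', weightedMass ν (G θ) S' := by
    rw [hY, Finset.mul_sum, Finset.mul_sum]
    exact Finset.sum_le_sum fun θ _ => le_weightedMass hR ν (G θ) hQ' (by linarith)
  refine le_trans ?_ (mul_le_mul_right hlow _)
  rw [← mul_assoc (ENNReal.ofReal (16 * _ * _)), ← ENNReal.ofReal_mul (by positivity)]
  calc ENNReal.ofReal (4 * lam ^ 2) * ν S' * (ENNReal.ofReal (4 / w ^ 2) * (n * Y))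
      = ENNReal.ofReal (4 * lam ^ 2 * (4 / w ^ 2) * n) * (ν S' * Y) := by
        rw [ENNReal.ofReal_mul (p := 4 * lam ^ 2 * (4 / w ^ 2)) (by positivity),
          ENNReal.ofReal_mul (p := 4 * lam ^ 2) (by positivity), ENNReal.ofReal_natCast]
        ring
    _ ≤ _ := by
        refine mul_le_mul_left (ENNReal.ofReal_le_ofReal ?_) _
        -- The seventh power: `R²` from the overlap `lam²`, `R` from the number of caps, and `R⁴`
        -- from `(lam' l / w)²`.
        calc 4 * lam ^ 2 * (4 / w ^ 2) * n
            ≤ 4 * R ^ 2 * (4 / w ^ 2) * ((4 * Real.pi * K + 2) * R) := by gcongr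
          _ = 16 * (4 * Real.pi * K + 2) * R ^ 7 * ((R * (R * w)) ^ 2)⁻¹ := by
              field_simp; ring
          _ ≤ _ := by
              rw [hlw]
              gcongr

end BallInflationEstimates
end BallInflation

namespace BallInflation

/-! ### Summation over the squares, using that the caps are good. -/

section BallInflationEstimates

variable {M : ℕ} {R K : ℝ}

/-- The upper bound for the mass of the tube attached to a good cap. -/
theorem measure_inter_tube_le_of_notMem_badCaps {𝒞 : CapSystem M R K} {ν : Measure Plane}
    {t : ℝ} {k : ℕ} (hk : k < M) {Q Q' : DyadicSquare} (hQ : Q ∈ squares M R k)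
    (hQ' : Q' ∈ squares M R (k + 1)) (hQQ' : Q.carrier ⊆ Q'.carrier) {θ : Arc}
    [IsProbabilityMeasure ν] (hθ : θ ∈ 𝒞.caps k) (hgood : θ ∉ badCaps 𝒞 ν t k Q) :
    ν (Q'.dilate (inflation M R (k + 1)) ∩ tube Q.center θ.mid (R ^ delta M * (radius M R k / R))
        (R ^ delta M * (radius M R (k + 1) / R))) ≤
      ENNReal.ofReal (R ^ (10 * delta M) * (radius M R k / radius M R (k + 1)) ^ min t 1) *
        ν (Q'.dilate (inflation M R (k + 1))) := by
  classical
  have hm := Q'.measurableSet_dilate (inflation M R (k + 1))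
  rw [badCaps, if_pos hk, Finset.mem_filter] at hgood
  push Not at hgood
  have h := hgood hθ Q hQ Q' hQ' Subset.rfl hQQ'
  rw [IsBad, not_lt] at h
  rw [← ProbabilityTheory.cond_mul_eq_inter hm _ ν]
  refine mul_le_mul_left ?_ _
  rw [← ofReal_measureReal]
  exact ENNReal.ofReal_le_ofReal h

/-- At a given point, the squares for which the cap `θ` is good and whose tubes in direction `θ`
contain the point have small total measure. -/
theorem tsum_good_measure_le (hR : 1 ≤ R) {𝒞 : CapSystem M R K} (ν : Measure Plane)
    [IsProbabilityMeasure ν] (t : ℝ) (hM : 3 ≤ M) (hX : 20 ≤ R ^ delta M ^ 2) {k : ℕ}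
    (hk : k < M) {Q' : DyadicSquare} (hQ' : Q' ∈ squares M R (k + 1)) {θ : Arc}
    (hθ : θ ∈ 𝒞.caps k) (y : Plane) [DecidablePred fun Q => θ ∉ badCaps 𝒞 ν t k Q] :
    ∑' Q : {Q : DyadicSquare // Q ∈ squares M R k ∧ Q.carrier ⊆ Q'.carrier},
      ν (Q.1.dilate (inflation M R k)) * (if θ ∉ badCaps 𝒞 ν t k Q.1 then
        (tube Q.1.center θ.mid (4 * (inflation M R k * R ^ delta M ^ 2) * (radius M R k / R))
          (4 * (inflation M R k * R ^ delta M ^ 2) * (radius M R (k + 1) / R))).indicator 1 y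
        else 0) ≤
    ENNReal.ofReal (4 * inflation M R k ^ 2 *
      (R ^ (10 * delta M) * (radius M R k / radius M R (k + 1)) ^ min t 1)) *
      ν (Q'.dilate (inflation M R (k + 1))) *
        (Q'.dilate (inflation M R (k + 1))).indicator 1 y := by
  have hR0 : 0 < R := by linarith
  have hrk := radius_pos (M := M) hR k
  have hrk1 := radius_pos (M := M) hR (k + 1)
  have h1 : 1 ≤ inflation M R k := one_le_inflation hR k
  have hle : inflation M R k ≤ inflation M R (k + 1) := inflation_mono hR k
  have hdel : inflation M R (k + 1) ≤ R ^ delta M := inflation_le_rpow_delta hR hM hk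
  have hsucc := inflation_succ (M := M) hR k
  have hgood := fun (Q : DyadicSquare) (hQ : Q ∈ squares M R k) (hQQ' : Q.carrier ⊆ Q'.carrier) =>
    measure_inter_tube_le_of_notMem_badCaps (t := t) (ν := ν) hk hQ hQ' hQQ' hθ
  set X := R ^ delta M ^ 2 with hXdef
  set lam := inflation M R k
  set lam' := inflation M R (k + 1)
  set w := radius M R k / R with hw
  set l := radius M R (k + 1) / R with hl
  set e : ℝ := R ^ (10 * delta M) * (radius M R k / radius M R (k + 1)) ^ min t 1 with he
  have he0 : 0 ≤ e := by positivity
  have hw0 : 0 < w := by positivity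
  have hl0 : 0 < l := by positivity
  have hwl : w ≤ l := by
    rw [hw, hl]; exact div_le_div_of_nonneg_right (radius_mono hR (Nat.le_succ k)) hR0.le
  -- In `lam' = lam X²` one `X` accounts for the enlarged tubes and the other beats the constant
  -- `20`.
  have hlX : 20 * (lam * X) ≤ lam' := by
    rw [hsucc]
    have : 0 ≤ lam * X := by positivity
    calc 20 * (lam * X) ≤ X * (lam * X) := by gcongr
      _ = _ := by ring
  have hlX1 : lam ≤ lam * X := le_mul_of_one_le_right (by linarith) (by linarith)
  have hside' := le_side_of_mem_squares hQ'
  have hs' := Q'.side_pos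
  rw [← hl] at hside'
  let T : DyadicSquare → Set Plane := fun Q => tube Q.center θ.mid (4 * (lam * X) * w)
    (4 * (lam * X) * l)
  let U : Set DyadicSquare := {Q | Q ∈ squares M R k ∧ Q.carrier ⊆ Q'.carrier}
  let V : Set DyadicSquare := {Q | Q ∈ U ∧ θ ∉ badCaps 𝒞 ν t k Q ∧ y ∈ T Q}
  have hsum : ∑' Q : U, ν (Q.1.dilate lam) * (if θ ∉ badCaps 𝒞 ν t k Q.1 then
        (T Q.1).indicator 1 y else 0) = ∑' Q : V, ν (Q.1.dilate lam) := by
    rw [tsum_subtype U fun Q => ν (Q.dilate lam) * (if θ ∉ badCaps 𝒞 ν t k Q then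
        (T Q).indicator 1 y else 0), tsum_subtype V fun Q => ν (Q.dilate lam)]
    congr 1
    ext Q
    simp only [V]
    by_cases a1 : Q ∈ U <;> by_cases a2 : θ ∉ badCaps 𝒞 ν t k Q <;> by_cases a3 : y ∈ T Q <;>
      simp [a1, a2, a3]
  refine hsum.trans_le ?_
  -- One contributing square `P` suffices: its tube will capture all the others.
  rcases V.eq_empty_or_nonempty with hV | ⟨P, ⟨hP, hPQ'⟩, hPgood, hyP⟩
  · rw [hV]; simp
  have hyS : y ∈ Q'.dilate lam' := by
    intro i
    have h2 : ‖y - P.center‖ ≤ 2 * (lam * X) * w + 2 * (lam * X) * l := by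
      refine abs_le_of_sq_le_sq' ?_ (by positivity) |>.2
      rw [norm_sq_eq_inner_unitVec _ θ.mid, ← sq_abs (inner ℝ _ _),
        ← sq_abs (inner ℝ _ (unitVec (θ.mid + Real.pi / 2)))]
      have h3 := hyP.1
      have h4 := hyP.2
      calc _ ≤ (4 * (lam * X) * l / 2) ^ 2 + (4 * (lam * X) * w / 2) ^ 2 := by gcongr
        _ ≤ _ := by
          have : 0 ≤ (lam * X * w) * (lam * X * l) := by positivity
          nlinarith
    have h5 : |(y - P.center) i| ≤ ‖y - P.center‖ := PiLp.norm_apply_le (y - P.center) i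
    rw [PiLp.sub_apply] at h5
    have h6 := DyadicSquare.abs_center_sub_le hPQ' i
    have h7 := P.side_pos
    have h8 : lam * X * w ≤ lam * X * (2 * Q'.side) := by gcongr; linarith
    have h9 : lam * X * l ≤ lam * X * (2 * Q'.side) := by gcongr
    have h10 : 20 * (lam * X) * Q'.side ≤ lam' * Q'.side := by gcongr
    have h11 : 1 * Q'.side ≤ lam * X * Q'.side := by gcongr; linarith
    have h12 : |y i - P.center i| ≤ 8 * (lam * X) * Q'.side := by linarith
    rw [abs_le] at h6 h12
    constructor <;> linarith [h6.1, h6.2, h12.1, h12.2]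
  rw [Set.indicator_of_mem hyS, Pi.one_apply, mul_one]
  -- Go from `x` to the centre of `Q`, then to `y`, then to the centre of `P`. The tubes are
  -- parallel, so the displacements add up to at most `5 lam X` times `l` along and `w` across.
  have hsub : ∀ Q ∈ V, Q.dilate lam ⊆ Q'.dilate lam' ∩
      tube P.center θ.mid (R ^ delta M * w) (R ^ delta M * l) := by
    rintro Q ⟨⟨hQ, hQQ'⟩, -, hyQ⟩ x hx
    refine ⟨DyadicSquare.dilate_subset hQQ' h1 hle hx, ?_⟩
    have h2 : ‖x - Q.center‖ ≤ lam * w := (DyadicSquare.norm_sub_center_le hx).trans (by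
      gcongr; exact side_le_of_mem_squares hR hQ)
    have h3 : lam * w ≤ lam * X * w := by gcongr
    have h4 : lam * X * w ≤ lam * X * l := by gcongr
    have hsplit : ∀ β, |inner ℝ (x - P.center) (unitVec β)| ≤ ‖x - Q.center‖ +
        |inner ℝ (y - Q.center) (unitVec β)| + |inner ℝ (y - P.center) (unitVec β)| := by
      intro β
      rw [show x - P.center = (x - Q.center) - (y - Q.center) + (y - P.center) by abel,
        inner_add_left, inner_sub_left]
      refine (abs_add_le _ _).trans (add_le_add_left ((abs_sub _ _).trans ?_) _)
      exact add_le_add_left (abs_inner_unitVec_le _ _) _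
    constructor
    · have h5 := hsplit θ.mid
      have h6 : |inner ℝ (y - Q.center) (unitVec θ.mid)| ≤ 4 * (lam * X) * l / 2 := hyQ.1
      have h7 : |inner ℝ (y - P.center) (unitVec θ.mid)| ≤ 4 * (lam * X) * l / 2 := hyP.1
      have h8 : 20 * (lam * X) * l ≤ R ^ delta M * l := by gcongr; linarith
      have h9 : 0 ≤ lam * X * l := by positivity
      linarith
    · have h5 := hsplit (θ.mid + Real.pi / 2)
      have h6 : |inner ℝ (y - Q.center) (unitVec (θ.mid + Real.pi / 2))| ≤
          4 * (lam * X) * w / 2 := hyQ.2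
      have h7 : |inner ℝ (y - P.center) (unitVec (θ.mid + Real.pi / 2))| ≤
          4 * (lam * X) * w / 2 := hyP.2
      have h8 : 20 * (lam * X) * w ≤ R ^ delta M * w := by gcongr; linarith
      have h9 : 0 ≤ lam * X * w := by positivity
      linarith
  refine (tsum_measure_dilate_le ν (Int.log 2 (radius M R k / R)) h1 V (fun Q hQ => hQ.1.1)
    ((Q'.measurableSet_dilate lam').inter (measurableSet_tube _ _ _ _)) hsub).trans ?_
  rw [ENNReal.ofReal_mul (p := 4 * lam ^ 2) (by positivity), mul_assoc]
  exact mul_le_mul_right (hgood P hP hPQ' hPgood) _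

open Classical in
/-- The main estimate, for large `R` and small `δ`. -/
theorem tsum_weightedMass_le_of_large (M : ℕ) (K Λ : ℝ) (hΛ : 1 ≤ Λ) {ψ : Plane → ℝ}
    (hψ : ContDiff ℝ ∞ ψ) (hψc : HasCompactSupport ψ) (hM : 3 ≤ M) :
    ∃ C : ℝ, 0 ≤ C ∧ ∃ D : ℕ → ℝ,
      ∀ (R ρ : ℝ), 1 ≤ R → R / Λ ≤ ρ → ρ ≤ Λ * R → 20 ≤ R ^ delta M ^ 2 →
      ∀ (𝒞 : CapSystem M R K) (χ : Cutoffs 𝒞) (μ ν : Measure Plane) [IsProbabilityMeasure μ]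
        [IsProbabilityMeasure ν] (t : ℝ), ∀ k < M, ∀ Q' ∈ squares M R (k + 1),
        ∀ θ' ∈ 𝒞.parentCaps k, ∀ m : ℕ,
        ∑' Q : {Q : DyadicSquare // Q ∈ squares M R k ∧ Q.carrier ⊆ Q'.carrier},
            weightedMass ν (goodPiece χ μ ν t ρ ψ k Q.1 θ') (Q.1.dilate (inflation M R k)) ≤
          ENNReal.ofReal (C * R ^ (14 * delta M) *
              (radius M R k / radius M R (k + 1)) ^ (min t 1 - 1)) * ∑ θ ∈ 𝒞.capsIn k θ',
            weightedMass ν (goodPiece χ μ ν t ρ ψ (k + 1) Q' θ)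
              (Q'.dilate (inflation M R (k + 1))) +
          ENNReal.ofReal (D m * R ^ 3 * ((R ^ delta M ^ 2) ^ m)⁻¹) := by
  obtain ⟨C, hC, D, hD, hloc⟩ := exists_local_estimate M K Λ hΛ hψ hψc
  refine ⟨4 * C, by positivity, fun m => 4 * (4 * Real.pi * K + 2) * D m, ?_⟩
  intro R ρ hR hρ hρ' hX 𝒞 χ μ ν _ _ t k hk Q' hQ' θ' hθ' m
  have hK := 𝒞.one_le_K hR (by omega)
  have hpi := Real.pi_pos
  have hR0 : 0 < R := by linarith
  have hρ0 : 0 < ρ := lt_of_lt_of_le (by positivity) hρ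
  have hrk := radius_pos (M := M) hR k
  have hrk1 := radius_pos (M := M) hR (k + 1)
  have h1 : 1 ≤ inflation M R k := one_le_inflation hR k
  have h1' : 1 ≤ inflation M R (k + 1) := one_le_inflation hR (k + 1)
  have hle : inflation M R k ≤ inflation M R (k + 1) := inflation_mono hR k
  have hdel : inflation M R (k + 1) ≤ R ^ delta M := inflation_le_rpow_delta hR hM hk
  have hlR : inflation M R k ≤ R := inflation_le_self hR (by omega) hk.le
  have hloc := fun Q : {Q : DyadicSquare // Q ∈ squares M R k ∧ Q.carrier ⊆ Q'.carrier} =>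
    hloc R ρ hR hρ hρ' 𝒞 χ μ ν t k hk Q' hQ' θ' hθ' Q.1 Q.2.1 Q.2.2 m (R ^ delta M ^ 2)
      (by linarith)
  have hpt := fun θ (hθ : θ ∈ 𝒞.caps k) => tsum_good_measure_le hR ν t hM hX hk hQ' hθ
  have htot := tsum_measure_children_le (M := M) (R := R) (k := k) (Q' := Q') hR ν
    MeasurableSet.univ (fun _ _ => subset_univ _)
  set X := R ^ delta M ^ 2 with hXdef
  set lam := inflation M R k
  set lam' := inflation M R (k + 1)
  set w := radius M R k / R with hw
  set l := radius M R (k + 1) / R with hl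
  set q := radius M R k / radius M R (k + 1) with hq
  have hw0 : 0 < w := by positivity
  have hl0 : 0 < l := by positivity
  have hq0 : 0 < q := by positivity
  have hX0 : 0 < X := by linarith
  set S' := Q'.dilate lam' with hS'
  set n := (𝒞.capsIn k θ').card with hn
  have hnR : (n : ℝ) ≤ (4 * Real.pi * K + 2) * R := by
    refine le_trans ?_ (𝒞.card_caps_le hR hk)
    exact_mod_cast Finset.card_le_card fun θ hθ => (CapSystem.mem_capsIn.1 hθ).1
  set G : Arc → Plane → ℂ := fun θ => goodPiece χ μ ν t ρ ψ (k + 1) Q' θ with hG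
  have hGm : ∀ θ, Measurable fun y => ‖G θ y‖ₑ ^ 2 := fun θ =>
    (continuous_goodPiece χ μ ν t hρ0.le hψ hψc hk Q' θ).measurable.enorm.pow_const 2
  let T : DyadicSquare → Arc → Set Plane := fun Q θ => tube Q.center θ.mid (4 * (lam * X) * w)
    (4 * (lam * X) * l)
  set a := ENNReal.ofReal (C * (w * l)⁻¹) with ha
  set τ := ENNReal.ofReal (D m * (X ^ m)⁻¹) with hτ
  have hstep : ∀ Q : {Q : DyadicSquare // Q ∈ squares M R k ∧ Q.carrier ⊆ Q'.carrier},
      weightedMass ν (goodPiece χ μ ν t ρ ψ k Q.1 θ') (Q.1.dilate lam) ≤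
      ∑ θ ∈ 𝒞.capsIn k θ', a * (∫⁻ y, ‖G θ y‖ₑ ^ 2 * (ν (Q.1.dilate lam) *
        (if θ ∉ badCaps 𝒞 ν t k Q.1 then (T Q.1 θ).indicator 1 y else 0))) +
      ν (Q.1.dilate lam) * (n * τ) := by
    intro Q
    refine (hloc Q).trans ?_
    rw [Finset.sum_add_distrib, mul_add, Finset.sum_filter, Finset.mul_sum]
    refine add_le_add (Finset.sum_le_sum fun θ _ => ?_) ?_
    · by_cases hb : θ ∈ badCaps 𝒞 ν t k Q.1
      · simp [hb]
      · rw [if_pos hb]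
        simp only [if_pos hb]
        refine le_of_eq ?_
        have hT : MeasurableSet (T Q.1 θ) := measurableSet_tube _ _ _ _
        rw [mul_left_comm, ← lintegral_indicator (show MeasurableSet (tube Q.1.center θ.mid _ _)
          from hT), ← lintegral_const_mul _ ((hGm θ).indicator hT)]
        congr 1
        refine lintegral_congr fun y => ?_
        by_cases hy : y ∈ T Q.1 θ
        · rw [Set.indicator_of_mem hy, Set.indicator_of_mem hy, Pi.one_apply, mul_one, mul_comm]
        · rw [Set.indicator_of_notMem hy, Set.indicator_of_notMem hy]; simp
    · rw [Finset.sum_const, nsmul_eq_mul]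
      gcongr
      exact Finset.card_filter_le _ _
  refine (ENNReal.tsum_le_tsum hstep).trans ?_
  rw [ENNReal.tsum_add, Summable.tsum_finsetSum fun _ _ => ENNReal.summable]
  refine add_le_add ?_ ?_
  · rw [Finset.mul_sum]
    refine Finset.sum_le_sum fun θ hθ => ?_
    have hθk := (CapSystem.mem_capsIn.1 hθ).1
    -- Exchange of sum and integral, so that the mass of the squares whose tube contains `y` is
    -- bounded for each `y`.
    rw [ENNReal.tsum_mul_left, ← lintegral_tsum]
    swap
    · intro Q
      refine ((hGm θ).mul (measurable_const.mul ?_)).aemeasurable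
      split_ifs
      · exact measurable_const
      · exact measurable_one.indicator (measurableSet_tube _ _ _ _)
    set E := 4 * lam ^ 2 * (R ^ (10 * delta M) * q ^ min t 1) with hE
    have hE0 : 0 ≤ E := by positivity
    calc a * ∫⁻ y, ∑' Q : {Q : DyadicSquare // Q ∈ squares M R k ∧ Q.carrier ⊆ Q'.carrier},
          ‖G θ y‖ₑ ^ 2 * (ν (Q.1.dilate lam) *
            (if θ ∉ badCaps 𝒞 ν t k Q.1 then (T Q.1 θ).indicator 1 y else 0))
        ≤ a * ∫⁻ y, (ENNReal.ofReal E * ν S') * S'.indicator (fun y => ‖G θ y‖ₑ ^ 2) y := by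
          gcongr with y
          rw [ENNReal.tsum_mul_left]
          refine (mul_le_mul_right (hpt θ hθk y) _).trans (le_of_eq ?_)
          by_cases hy : y ∈ S'
          · rw [Set.indicator_of_mem hy, Set.indicator_of_mem hy, Pi.one_apply, mul_one, mul_comm]
          · rw [Set.indicator_of_notMem hy, Set.indicator_of_notMem hy]; simp
      _ = a * ENNReal.ofReal E * (ν S' * ∫⁻ y in S', ‖G θ y‖ₑ ^ 2) := by
          rw [lintegral_const_mul _ ((hGm θ).indicator (Q'.measurableSet_dilate lam')),
            lintegral_indicator (Q'.measurableSet_dilate lam')]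
          ring
      _ ≤ ENNReal.ofReal (4 * C * R ^ (14 * delta M) * q ^ (min t 1 - 1)) *
            (ENNReal.ofReal ((lam' * l) ^ 2)⁻¹ * (ν S' * ∫⁻ y in S', ‖G θ y‖ₑ ^ 2)) := by
          rw [← mul_assoc (ENNReal.ofReal (4 * C * _ * _)), ha, ← ENNReal.ofReal_mul (by positivity),
            ← ENNReal.ofReal_mul (by positivity)]
          refine mul_le_mul_left (ENNReal.ofReal_le_ofReal ?_) _
          -- The loss `l / w = q⁻¹` is the ratio of the areas `l²` and `w l`.
          have hqe : q ^ (min t 1 - 1) = q ^ min t 1 * (l / w) := by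
            rw [Real.rpow_sub_one hq0.ne', hq, hl, hw]; field_simp
          -- Ten powers of `R^δ` come from the threshold for bad caps, four from `lam² lam'²`.
          have hRe : R ^ (14 * delta M) = R ^ (10 * delta M) * (R ^ delta M) ^ 4 := by
            rw [← Real.rpow_natCast (R ^ delta M), ← Real.rpow_mul hR0.le,
              ← Real.rpow_add hR0]
            congr 1; push_cast; ring
          have hlam4 : lam ^ 2 * lam' ^ 2 ≤ (R ^ delta M) ^ 4 := by
            calc lam ^ 2 * lam' ^ 2 ≤ (R ^ delta M) ^ 2 * (R ^ delta M) ^ 2 := by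
                  gcongr; exact hle.trans hdel
              _ = _ := by ring
          calc C * (w * l)⁻¹ * E
              = 4 * C * (R ^ (10 * delta M) * (lam ^ 2 * lam' ^ 2)) * (q ^ min t 1 * (l / w)) *
                  ((lam' * l) ^ 2)⁻¹ := by rw [hE]; field_simp
            _ ≤ _ := by rw [hqe, hRe]; gcongr
      _ ≤ _ := mul_le_mul_right (le_weightedMass hR ν (G θ) hQ' (by linarith)) _
  · rw [ENNReal.tsum_mul_right]
    refine (mul_le_mul_left htot _).trans ?_
    rw [measure_univ, mul_one, hτ, ← ENNReal.ofReal_natCast, ← ENNReal.ofReal_mul (by positivity),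
      ← ENNReal.ofReal_mul (by positivity)]
    apply ENNReal.ofReal_le_ofReal
    have := hD m
    calc 4 * lam ^ 2 * (n * (D m * (X ^ m)⁻¹))
        ≤ 4 * R ^ 2 * ((4 * Real.pi * K + 2) * R * (D m * (X ^ m)⁻¹)) := by gcongr
      _ = _ := by ring

end BallInflationEstimates

end BallInflation

/-! ### Choice of constants and conclusion. -/

open BallInflation

theorem lemma4p4 :
    ∃ C : ℝ, 0 < C ∧
      ∀ (M : ℕ) (K Λ : ℝ) (ψ : Plane → ℝ), 1 ≤ Λ →
        ContDiff ℝ ∞ ψ → HasCompactSupport ψ → (∀ ξ, 0 ≤ ψ ξ) →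
      ∃ (A : ℝ) (B : ℕ → ℝ),
        ∀ (R ρ : ℝ), 1 ≤ R → R / Λ ≤ ρ → ρ ≤ Λ * R →
        ∀ (𝒞 : CapSystem M R K) (χ : Cutoffs 𝒞)
          (μ ν : Measure Plane) [IsProbabilityMeasure μ] [IsProbabilityMeasure ν] (t : ℝ),
        ∀ k < M, ∀ Q' ∈ squares M R (k + 1), ∀ θ' ∈ 𝒞.parentCaps k, ∀ N : ℕ,
          ∑' Q : {Q : DyadicSquare // Q ∈ squares M R k ∧ Q.carrier ⊆ Q'.carrier},
              weightedMass ν (goodPiece χ μ ν t ρ ψ k Q.1 θ') (Q.1.dilate (inflation M R k))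
            ≤ ENNReal.ofReal (A * R ^ (C * delta M) *
                  (radius M R k / radius M R (k + 1)) ^ (min t 1 - 1)) *
                ∑ θ ∈ 𝒞.capsIn k θ',
                  weightedMass ν (goodPiece χ μ ν t ρ ψ (k + 1) Q' θ)
                    (Q'.dilate (inflation M R (k + 1)))
              + ENNReal.ofReal (B N * R ^ (-(N : ℝ))) := by
  -- `28 δ ≥ 7` when `M ≤ 2`, which absorbs the loss `R^7`; the main estimate needs only `14`.
  refine ⟨28, by norm_num, fun M K Λ ψ hΛ hψ hψc _ => ?_⟩
  -- The absolute value is there because `A₁` is fixed before any cap system is given, and only such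
  -- a system, with `M > 0`, forces `K ≥ 1`.
  set A₁ : ℝ := 16 * (4 * Real.pi * |K| + 2) * (20 ^ (4 ^ M)) ^ 7 with hA₁
  have hpi := Real.pi_pos
  have hA₁0 : 0 ≤ A₁ := by positivity
  have hδ := delta_pos M
  have h4 : (4 : ℝ) ^ M * delta M ^ 2 = 1 := by
    rw [show (4 : ℝ) = 2 ^ 2 by norm_num, ← pow_mul, mul_comm 2 M, pow_mul, ← mul_pow,
      two_pow_mul_delta, one_pow]
  have hXpow : ∀ R : ℝ, 1 ≤ R → (R ^ delta M ^ 2) ^ (4 ^ M) = R := fun R hR => by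
    rw [← Real.rpow_natCast, ← Real.rpow_mul (by linarith)]
    push_cast
    rw [mul_comm, h4, Real.rpow_one]
  -- the estimate with polynomial loss suffices for small `M` or bounded `R`
  have hsmall : ∀ (R ρ : ℝ), 1 ≤ R → R / Λ ≤ ρ → ρ ≤ Λ * R → (M < 3 ∨ R ^ delta M ^ 2 < 20) →
        ∀ (𝒞 : CapSystem M R K) (χ : Cutoffs 𝒞)
          (μ ν : Measure Plane) [IsProbabilityMeasure μ] [IsProbabilityMeasure ν] (t : ℝ),
        ∀ k < M, ∀ Q' ∈ squares M R (k + 1), ∀ θ' ∈ 𝒞.parentCaps k,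
          ∑' Q : {Q : DyadicSquare // Q ∈ squares M R k ∧ Q.carrier ⊆ Q'.carrier},
              weightedMass ν (goodPiece χ μ ν t ρ ψ k Q.1 θ') (Q.1.dilate (inflation M R k))
            ≤ ENNReal.ofReal (A₁ * R ^ (28 * delta M) *
                  (radius M R k / radius M R (k + 1)) ^ (min t 1 - 1)) *
                ∑ θ ∈ 𝒞.capsIn k θ',
                  weightedMass ν (goodPiece χ μ ν t ρ ψ (k + 1) Q' θ)
                    (Q'.dilate (inflation M R (k + 1))) := by
    intro R ρ hR hρ hρ' hcase 𝒞 χ μ ν _ _ t k hk Q' hQ' θ' hθ'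
    have hρ0 : 0 ≤ ρ := le_trans (by positivity) hρ
    refine (tsum_weightedMass_le_pow hR χ μ ν t hρ0 hψ hψc hk hQ' hθ').trans ?_
    refine mul_le_mul_left (ENNReal.ofReal_le_ofReal ?_) _
    have hK := 𝒞.one_le_K hR (by omega)
    have hrk := radius_pos (M := M) hR k
    have hrk1 := radius_pos (M := M) hR (k + 1)
    have hq : 1 ≤ (radius M R k / radius M R (k + 1)) ^ (min t 1 - 1) := by
      refine Real.one_le_rpow_of_pos_of_le_one_of_nonpos (by positivity) ?_ ?_
      · exact (div_le_one hrk1).2 (radius_mono hR (Nat.le_succ k))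
      · linarith [min_le_right t 1]
    have h7 : R ^ 7 ≤ (20 ^ (4 ^ M)) ^ 7 * R ^ (28 * delta M) := by
      rcases hcase with hM | hX
      · have hd : 1 ≤ 4 * delta M := by
          have h2 : (2 : ℝ) ^ M ≤ 4 := by
            calc (2 : ℝ) ^ M ≤ 2 ^ 2 := pow_le_pow_right₀ (by norm_num) (by omega)
              _ = 4 := by norm_num
          rw [← two_pow_mul_delta M]
          gcongr
        have h3 : R ^ 7 ≤ R ^ (28 * delta M) := by
          rw [← Real.rpow_natCast]
          exact Real.rpow_le_rpow_of_exponent_le hR (by push_cast; linarith)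
        have h5 : (1 : ℝ) ≤ (20 ^ (4 ^ M)) ^ 7 := one_le_pow₀ (one_le_pow₀ (by norm_num))
        exact h3.trans (le_mul_of_one_le_left (by positivity) h5)
      · have h3 : R ≤ 20 ^ (4 ^ M) := by
          calc R = (R ^ delta M ^ 2) ^ (4 ^ M) := (hXpow R hR).symm
            _ ≤ _ := by gcongr
        have h5 : 1 ≤ R ^ (28 * delta M) := Real.one_le_rpow hR (by positivity)
        exact (pow_le_pow_left₀ (by linarith) h3 7).trans
          (le_mul_of_one_le_right (by positivity) h5)
    calc 16 * (4 * Real.pi * K + 2) * R ^ 7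
        ≤ 16 * (4 * Real.pi * K + 2) * ((20 ^ (4 ^ M)) ^ 7 * R ^ (28 * delta M)) := by gcongr
      _ = A₁ * R ^ (28 * delta M) := by rw [hA₁, abs_of_pos (by linarith)]; ring
      _ ≤ _ := le_mul_of_one_le_right (by positivity) hq
  by_cases hM : M < 3
  · exact ⟨A₁, fun _ => 0, fun R ρ hR hρ hρ' 𝒞 χ μ ν _ _ t k hk Q' hQ' θ' hθ' N =>
      (hsmall R ρ hR hρ hρ' (Or.inl hM) 𝒞 χ μ ν t k hk Q' hQ' θ' hθ').trans le_self_add⟩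
  push Not at hM
  obtain ⟨C, hC, D, hlarge⟩ := tsum_weightedMass_le_of_large M K Λ hΛ hψ hψc hM
  -- As `(R^{δ²})^{4^M} = R`, this decay order gives `R^{-(N+3)}`, and three powers cancel the `R³`
  -- in front of the tail.
  refine ⟨A₁ + C, fun N => D (4 ^ M * (N + 3)), ?_⟩
  intro R ρ hR hρ hρ' 𝒞 χ μ ν _ _ t k hk Q' hQ' θ' hθ' N
  have hrk := radius_pos (M := M) hR k
  have hrk1 := radius_pos (M := M) hR (k + 1)
  by_cases hX : R ^ delta M ^ 2 < 20
  · refine (hsmall R ρ hR hρ hρ' (Or.inr hX) 𝒞 χ μ ν t k hk Q' hQ' θ' hθ').trans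
      (le_trans ?_ le_self_add)
    refine mul_le_mul_left (ENNReal.ofReal_le_ofReal ?_) _
    gcongr
    linarith
  push Not at hX
  refine (hlarge R ρ hR hρ hρ' hX 𝒞 χ μ ν t k hk Q' hQ' θ' hθ' (4 ^ M * (N + 3))).trans
    (add_le_add (mul_le_mul_left (ENNReal.ofReal_le_ofReal ?_) _) (le_of_eq ?_))
  · gcongr
    · linarith
    · norm_num
  · congr 1
    rw [pow_mul, hXpow R hR, pow_add, Real.rpow_neg (by linarith), Real.rpow_natCast]
    field_simp
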